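/- Let $(\mathcal B,\mathbb E,\mathfrak s)$ be an extriangulated category in the sense of Nakaoka–Palu: $\mathcal B$ is an additive category, $\mathbb E\colon\mathcal B^{\mathrm{op}}\times\mathcal B\to\mathit{Ab}$ is an additive bifunctor, and $\mathfrak s$ is an additive realization of $\mathbb E$, assigning to each $\delta\in\mathbb E(C,A)$ an equivalence class of sequences $A\to B\to C$, such that the axioms (ET3), (ET3)$^{\mathrm{op}}$, (ET4) and (ET4)$^{\mathrm{op}}$ hold. A *conflation* is a sequence $A\to B\to C$ whose class is $\mathfrak s(\delta)$ for some $\delta\in\mathbb E(C,A)$. Let $(\mathcal U,\mathcal V)$ be a (complete) cotorsion pair on $\mathcal B$: $\mathcal U$ and $\mathcal V$ are full additive subcategories closed under isomorphisms and direct summands, $\mathbb E(U,V)=0$ for all $U\in\mathcal U$ and $V\in\mathcal V$, and every object $B$ of $\mathcal B$ admits conflations $V_B\to U_B\to B$ and $B\to V^B\to U^B$ with $U_B,U^B\in\mathcal U$ and $V_B,V^B\in\mathcal V$. Put $\mathcal W=\mathcal U\cap\mathcal V$. Let $\mathcal B^+$ be the full subcategory of the objects $B$ admitting a conflation $V\to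 W\to B$ with $V\in\mathcal V$, $W\in\mathcal W$, and let $\mathcal B^-$ be the full subcategory of the objects $B$ admitting a conflation $B\to W\to U$ with $W\in\mathcal W$, $U\in\mathcal U$. Let $\pi\colon\mathcal B\to\mathcal B/\mathcal W$ be the quotient functor, where $\mathcal B/\mathcal W$ has the same objects as $\mathcal B$ and two morphisms are identified when their difference factors through an object of $\mathcal W$. Write $\underline{\mathcal B}^{\pm}=\mathcal B^{\pm}/\mathcal W$ and $\underline{\mathcal H}=(\mathcal B^+\cap\mathcal B^-)/\mathcal W$ (the *heart*) for the full subcategories of $\mathcal B/\mathcal W$ on the objects of $\mathcal B^{\pm}$ and of $\mathcal B^+\cap\mathcal B^-$. A *reflection sequence* for $B$ is a conflation $B\xrightarrow{z}Z\to U$ with $Z\in\mathcal B^+$ and $U\in\mathcal U$ such that $z^*\colon\mathbb E(Z,V)\to\mathbb E(B,V)$ is surjective for every $V\in\mathcal V$; a *coreflection sequence* for $B$ is a conflation $V\to X\xrightarrow{x}B$ with $X\in\mathcal B^-$ and $V\in\mathcal V$ such that $x_*\colon\mathbb E(U,X)\to\mathbb E(U,B)$ is surjective for every $U\in\mathcal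 U$. Every object has both. Any choice of a reflection sequence $B\to B^+\to U$ for each object $B$ defines a functor $\sigma^+\colon\mathcal B/\mathcal W\to\underline{\mathcal B}^+$, $B\mapsto B^+$, left adjoint to the inclusion; any choice of a coreflection sequence $V\to B^-\to B$ for each object $B$ defines a functor $\sigma^-\colon\mathcal B/\mathcal W\to\underline{\mathcal B}^-$, $B\mapsto B^-$, right adjoint to the inclusion; and $\sigma^-$ sends objects of $\mathcal B^+$ into $\underline{\mathcal H}$. **Theorem.** For any such choices, the heart $\underline{\mathcal H}$, with its addition of morphisms inherited from $\mathcal B/\mathcal W$, is an abelian category, and the associated functor $$H=\sigma^-\circ\sigma^+\circ\pi\colon\ \mathcal B\longrightarrow\underline{\mathcal H}$$ is cohomological: it is additive, and for every conflation $A\xrightarrow{x}B\xrightarrow{y}C$ the sequence $H(A)\xrightarrow{H(x)}H(B)\xrightarrow{H(y)}H(C)$ is exact in $\underline{\mathcal H}$. -/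

import Mathlib

open CategoryTheory CategoryTheory.Limits Opposite

universe w v u

noncomputable section

namespace ExtriCat

variable {C : Type u} [Category.{v} C]

/-! ### Extensions with respect to a bifunctor -/

/-- The abelian group `𝔼(Z, A)`, contravariant in `Z` and covariant in `A`; its elements are the
`𝔼`-extensions. -/
abbrev Ext (E : Cᵒᵖ ⥤ C ⥤ AddCommGrpCat.{w}) (Z A : C) : Type w :=
  (E.obj (op Z)).obj A

/-- `a_* δ`. -/
def push (E : Cᵒᵖ ⥤ C ⥤ AddCommGrpCat.{w}) {Z A A' : C} (a : A ⟶ A') :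
    Ext E Z A →+ Ext E Z A' :=
  ((E.obj (op Z)).map a).hom

/-- `c^* δ`. -/
def pull (E : Cᵒᵖ ⥤ C ⥤ AddCommGrpCat.{w}) {Z Z' A : C} (c : Z' ⟶ Z) :
    Ext E Z A →+ Ext E Z' A :=
  ((E.map c.op).app A).hom

/-! ### Functoriality of extensions -/

section Functoriality

variable (E : Cᵒᵖ ⥤ C ⥤ AddCommGrpCat.{w})

lemma push_id {Z A : C} (δ : Ext E Z A) : push E (𝟙 A) δ = δ := by
  simp [push]

lemma push_comp {Z A A' A'' : C} (a : A ⟶ A') (b : A' ⟶ A'') (δ : Ext E Z A) :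
    push E (a ≫ b) δ = push E b (push E a δ) := by
  simp [push]

lemma pull_id {Z A : C} (δ : Ext E Z A) : pull E (𝟙 Z) δ = δ := by
  simp [pull]

lemma pull_comp {Z Z' Z'' A : C} (c : Z'' ⟶ Z') (d : Z' ⟶ Z) (δ : Ext E Z A) :
    pull E (c ≫ d) δ = pull E c (pull E d δ) := by
  simp [pull]

lemma push_pull {Z Z' A A' : C} (a : A ⟶ A') (c : Z' ⟶ Z) (δ : Ext E Z A) :
    push E a (pull E c δ) = pull E c (push E a δ) :=
  (ConcreteCategory.congr_hom ((E.map c.op).naturality a) δ).symm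

lemma pull_sub [Preadditive C] (hE : E.Additive) {Z Z' A : C} (c d : Z' ⟶ Z) (δ : Ext E Z A) :
    pull E (c - d) δ = pull E c δ - pull E d δ := by
  simp [pull]

lemma push_sub [Preadditive C] (hE : ∀ X, (E.obj X).Additive) {Z A A' : C} (c d : A ⟶ A') (δ : Ext E Z A) :
    push E (c - d) δ = push E c δ - push E d δ := by
  have := hE (op Z)
  simp [push, Functor.map_sub]

end Functoriality

/-- The sum `δ ⊕ δ'` of two extensions, the element of `𝔼(Z ⊕ Z', A ⊕ A')` whose matrix of
components is diagonal with entries `δ` and `δ'`. -/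
def extSum [Preadditive C] [HasBinaryBiproducts C] (E : Cᵒᵖ ⥤ C ⥤ AddCommGrpCat.{w}) {Z A Z' A' : C}
    (δ : Ext E Z A) (δ' : Ext E Z' A') : Ext E (Z ⊞ Z') (A ⊞ A') :=
  pull E biprod.fst (push E biprod.inl δ) + pull E biprod.snd (push E biprod.inr δ')

/-! ### Equivalence classes of sequences -/

/-- A sequence of morphisms `A ⟶ mid ⟶ Z`. -/
structure Sequence (A Z : C) where
  mid : C
  fst : A ⟶ mid
  snd : mid ⟶ Z

/-- Two sequences with the same ends are equivalent if their middle terms are isomorphic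
compatibly with the identities of the ends. -/
def sequenceSetoid (A Z : C) : Setoid (Sequence A Z) where
  r S S' := ∃ b : S.mid ≅ S'.mid, S.fst ≫ b.hom = S'.fst ∧ b.hom ≫ S'.snd = S.snd
  iseqv :=
    { refl := fun S => ⟨Iso.refl _, by simp, by simp⟩
      symm := by
        rintro S S' ⟨b, h₁, h₂⟩
        exact ⟨b.symm, by simp [← h₁], by simp [← h₂]⟩
      trans := by
        rintro S S' S'' ⟨b, h₁, h₂⟩ ⟨b', h₁', h₂'⟩
        exact ⟨b ≪≫ b', by simp [← h₁', ← h₁], by simp [← h₂, ← h₂']⟩ }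

/-- Equivalence classes of sequences `A ⟶ B ⟶ Z`. -/
abbrev SequenceClass (A Z : C) : Type (max u v) := Quotient (sequenceSetoid A Z)

/-- The class `[A ⟶ B ⟶ Z]`. -/
def classOf {A B Z : C} (x : A ⟶ B) (y : B ⟶ Z) : SequenceClass A Z :=
  Quotient.mk (sequenceSetoid A Z) ⟨B, x, y⟩

lemma classOf_eq_of_iso {A B B' Z : C} {x : A ⟶ B} {y : B ⟶ Z} {x' : A ⟶ B'} {y' : B' ⟶ Z}
    (b : B ≅ B') (h₁ : x ≫ b.hom = x') (h₂ : b.hom ≫ y' = y) : classOf x y = classOf x' y' :=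
  Quotient.sound (s := sequenceSetoid A Z) ⟨b, h₁, h₂⟩

/-! ### Extriangulated categories -/

/-- The structure of an extriangulated category on an additive category `C`. -/
structure Extriangulated (C : Type u) [Category.{v} C] [Preadditive C] [HasZeroObject C] [HasBinaryBiproducts C] where
  /-- (ET1): an additive bifunctor. -/
  E : Cᵒᵖ ⥤ C ⥤ AddCommGrpCat.{w}
  additive_left : E.Additive
  additive_right : ∀ X : Cᵒᵖ, (E.obj X).Additive
  /-- (ET2): the additive realization. -/
  s : ∀ {A Z : C}, Ext E Z A → SequenceClass A Z
  realize : ∀ {A Z A' Z' : C} (δ : Ext E Z A) (δ' : Ext E Z' A')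
    {B B' : C} (x : A ⟶ B) (y : B ⟶ Z) (x' : A' ⟶ B') (y' : B' ⟶ Z'),
    s δ = classOf x y → s δ' = classOf x' y' →
    ∀ (a : A ⟶ A') (c : Z ⟶ Z'), push E a δ = pull E c δ' →
      ∃ b : B ⟶ B', x ≫ b = a ≫ x' ∧ y ≫ c = b ≫ y'
  s_zero : ∀ A Z : C,
    s (0 : Ext E Z A) = classOf (biprod.inl : A ⟶ A ⊞ Z) (biprod.snd : A ⊞ Z ⟶ Z)
  s_sum : ∀ {A Z A' Z' : C} (δ : Ext E Z A) (δ' : Ext E Z' A')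
    {B B' : C} (x : A ⟶ B) (y : B ⟶ Z) (x' : A' ⟶ B') (y' : B' ⟶ Z'),
    s δ = classOf x y → s δ' = classOf x' y' →
    s (extSum E δ δ') = classOf (biprod.map x x') (biprod.map y y')
  /-- (ET3) -/
  et3 : ∀ {A Z A' Z' : C} (δ : Ext E Z A) (δ' : Ext E Z' A')
    {B B' : C} (x : A ⟶ B) (y : B ⟶ Z) (x' : A' ⟶ B') (y' : B' ⟶ Z'),
    s δ = classOf x y → s δ' = classOf x' y' →
    ∀ (a : A ⟶ A') (b : B ⟶ B'), x ≫ b = a ≫ x' →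
      ∃ c : Z ⟶ Z', push E a δ = pull E c δ' ∧ y ≫ c = b ≫ y'
  /-- The dual of (ET3). -/
  et3_op : ∀ {A Z A' Z' : C} (δ : Ext E Z A) (δ' : Ext E Z' A')
    {B B' : C} (x : A ⟶ B) (y : B ⟶ Z) (x' : A' ⟶ B') (y' : B' ⟶ Z'),
    s δ = classOf x y → s δ' = classOf x' y' →
    ∀ (b : B ⟶ B') (c : Z ⟶ Z'), y ≫ c = b ≫ y' →
      ∃ a : A ⟶ A', push E a δ = pull E c δ' ∧ x ≫ b = a ≫ x'
  /-- (ET4) -/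
  et4 : ∀ {A B D X F : C} (δ : Ext E D A) (δ' : Ext E F B)
    (f : A ⟶ B) (f' : B ⟶ D) (g : B ⟶ X) (g' : X ⟶ F),
    s δ = classOf f f' → s δ' = classOf g g' →
    ∃ (Y : C) (d : D ⟶ Y) (e : Y ⟶ F) (h' : X ⟶ Y) (δ'' : Ext E Y A),
      f' ≫ d = g ≫ h' ∧ h' ≫ e = g' ∧
      s δ'' = classOf (f ≫ g) h' ∧
      s (push E f' δ') = classOf d e ∧
      pull E d δ'' = δ ∧
      push E f δ'' = pull E e δ'
  /-- The dual of (ET4). -/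
  et4_op : ∀ {D A B F X : C} (δ : Ext E B D) (δ' : Ext E X F)
    (f' : D ⟶ A) (f : A ⟶ B) (g' : F ⟶ B) (g : B ⟶ X),
    s δ = classOf f' f → s δ' = classOf g' g →
    ∃ (Y : C) (d : D ⟶ Y) (e : Y ⟶ F) (h' : Y ⟶ A) (δ'' : Ext E X Y),
      e ≫ g' = h' ≫ f ∧ d ≫ h' = f' ∧
      s δ'' = classOf h' (f ≫ g) ∧
      s (pull E g' δ) = classOf d e ∧
      push E e δ'' = δ' ∧
      pull E g δ'' = push E d δ

lemma exists_isZero [HasZeroObject C] : ∃ O : C, IsZero O :=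
  ⟨_, isZero_zero C⟩

variable [Preadditive C] [HasZeroObject C] [HasBinaryBiproducts C]

namespace Extriangulated

variable (T : Extriangulated.{w} C)

/-- The sequence `A ⟶ B ⟶ Z` realizes the extension `δ`. -/
def Realizes {A B Z : C} (δ : Ext T.E Z A) (x : A ⟶ B) (y : B ⟶ Z) : Prop :=
  T.s δ = classOf x y

/-- A conflation is a sequence which realizes some extension. -/
def Conflation {A B Z : C} (x : A ⟶ B) (y : B ⟶ Z) : Prop :=
  ∃ δ : Ext T.E Z A, T.Realizes δ x y

/-- `Cone(P, Q)`: the objects `B` admitting a conflation `X ⟶ Y ⟶ B` with `X ∈ P`, `Y ∈ Q`. -/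
def cone (P Q : ObjectProperty C) : ObjectProperty C := fun B =>
  ∃ (X Y : C) (x : X ⟶ Y) (y : Y ⟶ B), P X ∧ Q Y ∧ T.Conflation x y

/-- `CoCone(P, Q)`: the objects `B` admitting a conflation `B ⟶ X ⟶ Y` with `X ∈ P`, `Y ∈ Q`. -/
def cocone (P Q : ObjectProperty C) : ObjectProperty C := fun B =>
  ∃ (X Y : C) (x : B ⟶ X) (y : X ⟶ Y), P X ∧ Q Y ∧ T.Conflation x y

end Extriangulated

/-- A full additive subcategory which is closed under isomorphisms and direct summands. -/
structure IsAdditiveSubcategory (P : ObjectProperty C) : Prop where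
  of_iso : ∀ {X Y : C}, (X ≅ Y) → P X → P Y
  zero : ∀ X : C, IsZero X → P X
  biprod : ∀ X Y : C, P X → P Y → P (X ⊞ Y)
  summand : ∀ X Y : C, P (X ⊞ Y) → P X

/-- A (complete) cotorsion pair on an extriangulated category. -/
structure CotorsionPair (T : Extriangulated.{w} C) where
  U : ObjectProperty C
  V : ObjectProperty C
  hU : IsAdditiveSubcategory U
  hV : IsAdditiveSubcategory V
  ext_eq_zero : ∀ X Y : C, U X → V Y → ∀ δ : Ext T.E X Y, δ = 0
  left_res : ∀ B : C, ∃ (Y X : C) (y : Y ⟶ X) (x : X ⟶ B), V Y ∧ U X ∧ T.Conflation y x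
  right_res : ∀ B : C, ∃ (Y X : C) (y : B ⟶ Y) (x : Y ⟶ X), V Y ∧ U X ∧ T.Conflation y x

/-- An additive functor from an extriangulated category to an abelian category is cohomological
if it sends every conflation `A ⟶ B ⟶ Z` to an exact sequence. -/
def IsCohomological (T : Extriangulated.{w} C) {D : Type*} [Category* D] [Abelian D]
    (F : C ⥤ D) : Prop :=
  F.Additive ∧ ∀ {A B Z : C} (x : A ⟶ B) (y : B ⟶ Z), T.Conflation x y →
    ∃ hxy : F.map x ≫ F.map y = 0, (ShortComplex.mk (F.map x) (F.map y) hxy).Exact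

/-! ### Elementary facts on extriangulated categories -/

namespace Extriangulated

variable (T : Extriangulated.{w} C)

lemma exists_realizes {Z A : C} (δ : Ext T.E Z A) :
    ∃ (B : C) (x : A ⟶ B) (y : B ⟶ Z), T.Realizes δ x y := by
  obtain ⟨⟨B, x, y⟩, h⟩ := Quotient.exists_rep (T.s δ)
  exact ⟨B, x, y, h.symm⟩

lemma realizes_id_zero (A O : C) (hO : IsZero O) :
    T.Realizes (0 : Ext T.E O A) (𝟙 A) (0 : A ⟶ O) := by
  refine (T.s_zero A O).trans (classOf_eq_of_iso
    ⟨biprod.fst, biprod.inl, ?_, by simp⟩ (by simp) (hO.eq_of_tgt _ _))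
  apply biprod.hom_ext
  · simp
  · exact hO.eq_of_tgt _ _

lemma realizes_zero_id (Z O : C) (hO : IsZero O) :
    T.Realizes (0 : Ext T.E Z O) (0 : O ⟶ Z) (𝟙 Z) := by
  refine (T.s_zero O Z).trans (classOf_eq_of_iso
    ⟨biprod.snd, biprod.inr, ?_, by simp⟩ (hO.eq_of_src _ _) (by simp))
  apply biprod.hom_ext
  · exact hO.eq_of_tgt _ _
  · simp

variable {T}

variable {A B Z : C} {δ : Ext T.E Z A} {x : A ⟶ B} {y : B ⟶ Z}

namespace Realizes

lemma comp_eq_zero (h : T.Realizes δ x y) : x ≫ y = 0 := by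
  obtain ⟨O, hO⟩ := exists_isZero (C := C)
  obtain ⟨c, -, hc⟩ := T.et3 _ _ _ _ _ _ (T.realizes_id_zero A O hO) h (𝟙 A) x rfl
  rw [← hc, zero_comp]

lemma push_eq_zero (h : T.Realizes δ x y) : push T.E x δ = 0 := by
  obtain ⟨O, hO⟩ := exists_isZero (C := C)
  obtain ⟨c, hc, -⟩ := T.et3 _ _ _ _ _ _ h (T.realizes_id_zero B O hO) x (𝟙 B) rfl
  rw [hc, map_zero]

lemma pull_eq_zero (h : T.Realizes δ x y) : pull T.E y δ = 0 := by
  obtain ⟨O, hO⟩ := exists_isZero (C := C)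
  obtain ⟨a, ha, -⟩ := T.et3_op _ _ _ _ _ _ (T.realizes_zero_id B O hO) h (𝟙 B) y rfl
  rw [← ha, map_zero]

lemma exists_desc (h : T.Realizes δ x y) {X : C} (f : B ⟶ X) (hf : x ≫ f = 0) :
    ∃ g : Z ⟶ X, y ≫ g = f := by
  obtain ⟨O, hO⟩ := exists_isZero (C := C)
  obtain ⟨c, -, hc⟩ := T.et3 _ _ _ _ _ _ h (T.realizes_zero_id X O hO) 0 f (by simp [hf])
  exact ⟨c, by simpa using hc⟩

lemma exists_lift (h : T.Realizes δ x y) {X : C} (f : X ⟶ B) (hf : f ≫ y = 0) :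
    ∃ g : X ⟶ A, g ≫ x = f := by
  obtain ⟨O, hO⟩ := exists_isZero (C := C)
  obtain ⟨a, -, ha⟩ := T.et3_op _ _ _ _ _ _ (T.realizes_id_zero X O hO) h f 0 (by simp [hf])
  exact ⟨a, by simpa using ha.symm⟩

lemma exists_lift_of_pull (h : T.Realizes δ x y) {X : C} (f : X ⟶ Z) (hf : pull T.E f δ = 0) :
    ∃ g : X ⟶ B, g ≫ y = f := by
  obtain ⟨b, -, hb⟩ := T.realize _ _ _ _ _ _ (T.s_zero A X) h (𝟙 A) f (by rw [hf, map_zero])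
  exact ⟨biprod.inr ≫ b, by rw [Category.assoc, ← hb]; simp⟩

lemma exists_desc_of_push (h : T.Realizes δ x y) {X : C} (f : A ⟶ X) (hf : push T.E f δ = 0) :
    ∃ g : B ⟶ X, x ≫ g = f := by
  obtain ⟨b, hb, -⟩ := T.realize _ _ _ _ _ _ h (T.s_zero X Z) f (𝟙 Z) (by rw [hf, map_zero])
  exact ⟨b ≫ biprod.fst, by rw [← Category.assoc, hb]; simp⟩

lemma exists_pull_eq (h : T.Realizes δ x y) {X : C} (β : Ext T.E X A) (hβ : push T.E x β = 0) :
    ∃ g : X ⟶ Z, pull T.E g δ = β := by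
  obtain ⟨M, i, m, hM⟩ := T.exists_realizes β
  obtain ⟨k, hk⟩ := hM.exists_desc_of_push x hβ
  obtain ⟨g, hg, -⟩ := T.et3 _ _ _ _ _ _ hM h (𝟙 A) k (by simp [hk])
  exact ⟨g, by rw [← hg, push_id]⟩

lemma exists_push_eq (h : T.Realizes δ x y) {X : C} (β : Ext T.E Z X) (hβ : pull T.E y β = 0) :
    ∃ g : A ⟶ X, push T.E g δ = β := by
  obtain ⟨M, i, m, hM⟩ := T.exists_realizes β
  obtain ⟨k, hk⟩ := hM.exists_lift_of_pull y hβ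
  obtain ⟨g, hg, -⟩ := T.et3_op _ _ _ _ _ _ h hM k (𝟙 Z) (by simp [hk])
  exact ⟨g, by rw [hg, pull_id]⟩

lemma exists_push_eq_mid (h : T.Realizes δ x y) {X : C} (β : Ext T.E X B)
    (hβ : push T.E y β = 0) : ∃ α : Ext T.E X A, push T.E x α = β := by
  obtain ⟨M, i, m, hM⟩ := T.exists_realizes β
  obtain ⟨Y, d, e, h', δ'', -, -, -, h₁, -, h₂⟩ := T.et4 _ _ _ _ _ _ h hM
  rw [hβ] at h₁
  obtain ⟨r, hr⟩ := Realizes.exists_lift_of_pull (T := T) h₁ (𝟙 X) (map_zero _)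
  refine ⟨pull T.E r δ'', ?_⟩
  rw [push_pull, h₂, ← pull_comp, hr, pull_id]

lemma exists_pull_eq_mid (h : T.Realizes δ x y) {X : C} (β : Ext T.E B X)
    (hβ : pull T.E x β = 0) : ∃ α : Ext T.E Z X, pull T.E y α = β := by
  obtain ⟨M, i, m, hM⟩ := T.exists_realizes β
  obtain ⟨Y, d, e, h', δ'', -, -, -, h₁, -, h₂⟩ := T.et4_op _ _ _ _ _ _ hM h
  rw [hβ] at h₁
  obtain ⟨r, hr⟩ := Realizes.exists_desc_of_push (T := T) h₁ (𝟙 X) (map_zero _)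
  refine ⟨push T.E r δ'', ?_⟩
  rw [← push_pull, h₂, ← push_comp, hr, push_id]

end Realizes

end Extriangulated

/-! ### The core, the heart and the (co)reflections attached to a cotorsion pair -/

namespace CotorsionPair

variable {T : Extriangulated.{w} C} (h : CotorsionPair T)

/-- The core `U ∩ V`. -/
def core : ObjectProperty C := fun X => h.U X ∧ h.V X

/-- `B⁺ = Cone(V, U ∩ V)`. -/
def plus : ObjectProperty C := T.cone h.V h.core

/-- `B⁻ = CoCone(U ∩ V, U)`. -/
def minus : ObjectProperty C := T.cocone h.core h.U

/-- Two parallel morphisms are identified in the quotient by the core if their difference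
factors through an object of the core. -/
def rel : HomRel C := fun X Y f g =>
  ∃ (M : C) (a : X ⟶ M) (b : M ⟶ Y), h.core M ∧ f - g = a ≫ b

lemma rel_add {X Y : C} {f₁ f₂ g₁ g₂ : X ⟶ Y} (hf : h.rel f₁ f₂) (hg : h.rel g₁ g₂) :
    h.rel (f₁ + g₁) (f₂ + g₂) := by
  obtain ⟨M, a, b, hM, e⟩ := hf
  obtain ⟨M', a', b', hM', e'⟩ := hg
  refine ⟨M ⊞ M', biprod.lift a a', biprod.desc b b',
    ⟨h.hU.biprod _ _ hM.1 hM'.1, h.hV.biprod _ _ hM.2 hM'.2⟩, ?_⟩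
  rw [biprod.lift_desc, ← e, ← e']
  abel

instance rel_congruence : Congruence h.rel where
  equivalence :=
    { refl := fun f => by
        obtain ⟨O, hO⟩ := exists_isZero (C := C)
        exact ⟨O, 0, 0, ⟨h.hU.zero _ hO, h.hV.zero _ hO⟩, by simp⟩
      symm := by
        rintro f g ⟨M, a, b, hM, e⟩
        exact ⟨M, -a, b, hM, by rw [Preadditive.neg_comp, ← e]; abel⟩
      trans := by
        intro f g k hfg hgk
        obtain ⟨M, a, b, hM, e⟩ := h.rel_add hfg hgk
        exact ⟨M, a, b, hM, by rw [← e]; abel⟩ }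
  comp_left := by
    rintro X Y Z f g g' ⟨M, a, b, hM, e⟩
    exact ⟨M, f ≫ a, b, hM, by rw [← Preadditive.comp_sub, e, Category.assoc]⟩
  comp_right := by
    rintro X Y Z f f' g ⟨M, a, b, hM, e⟩
    exact ⟨M, a, b ≫ g, hM, by rw [← Preadditive.sub_comp, e, Category.assoc]⟩

/-- The quotient category `C / (U ∩ V)`. -/
abbrev Quo : Type u := Quotient h.rel

instance quoPreadditive : Preadditive h.Quo :=
  Quotient.preadditive h.rel fun _ _ _ _ _ _ => h.rel_add

/-- The quotient functor `π`. -/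
abbrev toQuo : C ⥤ h.Quo := Quotient.functor h.rel

/-- `B⁺ / (U ∩ V)`, a full subcategory of `C / (U ∩ V)`. -/
def quoPlus : ObjectProperty h.Quo := fun X => h.plus X.as

/-- `B⁻ / (U ∩ V)`, a full subcategory of `C / (U ∩ V)`. -/
def quoMinus : ObjectProperty h.Quo := fun X => h.minus X.as

/-- The objects of `B⁺ ∩ B⁻`, as objects of `C / (U ∩ V)`. -/
def quoHeart : ObjectProperty h.Quo := fun X => h.plus X.as ∧ h.minus X.as

/-- The heart `(B⁺ ∩ B⁻) / (U ∩ V)`. -/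
abbrev Heart : Type u := h.quoHeart.FullSubcategory

/-- The additive structure of the heart: morphisms are added as in `C / (U ∩ V)`. -/
instance heartPreadditive : Preadditive h.Heart :=
  Preadditive.fullSubcategory h.quoHeart

/-- A reflection sequence `B ⟶ R ⟶ S` for `B`. -/
structure ReflectionSequence (B : C) where
  R : C
  S : C
  z : B ⟶ R
  p : R ⟶ S
  plus_R : h.plus R
  U_S : h.U S
  conflation : T.Conflation z p
  surjective : ∀ Y : C, h.V Y → Function.Surjective (pull T.E z : Ext T.E R Y → Ext T.E B Y)

/-- A coreflection sequence `S ⟶ R ⟶ B` for `B`. -/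
structure CoreflectionSequence (B : C) where
  R : C
  S : C
  i : S ⟶ R
  z : R ⟶ B
  minus_R : h.minus R
  V_S : h.V S
  conflation : T.Conflation i z
  surjective : ∀ X : C, h.U X → Function.Surjective (push T.E z : Ext T.E X R → Ext T.E X B)

lemma map_eq_iff {X Y : C} (f g : X ⟶ Y) : h.toQuo.map f = h.toQuo.map g ↔ h.rel f g :=
  Quotient.functor_map_eq_iff _ _ _

variable {h}

lemma U_of_ext_eq_zero {X : C} (hX : ∀ Y, h.V Y → ∀ δ : Ext T.E X Y, δ = 0) : h.U X := by
  obtain ⟨Y, X', y, x, hY, hX', δ, hδ⟩ := h.left_res X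
  rw [hX Y hY δ] at hδ
  obtain ⟨b, -, -⟩ := Quotient.exact ((T.s_zero Y X).symm.trans hδ)
  exact h.hU.summand X Y (h.hU.of_iso (b.symm ≪≫ biprod.braiding Y X) hX')

lemma V_of_ext_eq_zero {Y : C} (hY : ∀ X, h.U X → ∀ δ : Ext T.E X Y, δ = 0) : h.V Y := by
  obtain ⟨Y', X, y, x, hY', hX, δ, hδ⟩ := h.right_res Y
  rw [hY X hX δ] at hδ
  obtain ⟨b, -, -⟩ := Quotient.exact ((T.s_zero Y X).symm.trans hδ)
  exact h.hV.summand Y X (h.hV.of_iso b.symm hY')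

/-- Every object has a reflection sequence. -/
lemma nonempty_reflectionSequence (B : C) : Nonempty (h.ReflectionSequence B) := by
  obtain ⟨Y, X, y, x, hY, hX, δ, hδ⟩ := h.left_res B
  obtain ⟨M, S, m, q, hM, hS, δ', hδ'⟩ := h.right_res X
  obtain ⟨R, d, e, t, δ'', -, -, h₁, h₂, h₃, -⟩ := T.et4 _ _ _ _ _ _ hδ hδ'
  refine ⟨⟨R, S, d, e, ⟨Y, M, _, t, hY, ⟨?_, hM⟩, δ'', h₁⟩, hS, ⟨_, h₂⟩, ?_⟩⟩
  · refine U_of_ext_eq_zero fun V hV β => ?_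
    obtain ⟨α, hα⟩ := Extriangulated.Realizes.exists_pull_eq_mid hδ' β (h.ext_eq_zero _ _ hX hV _)
    rw [← hα, h.ext_eq_zero _ _ hS hV α, map_zero]
  · intro V hV β
    obtain ⟨g, hg⟩ := Extriangulated.Realizes.exists_push_eq hδ β (h.ext_eq_zero _ _ hX hV _)
    exact ⟨push T.E g δ'', by rw [← push_pull, h₃, hg]⟩

/-- Every object has a coreflection sequence. -/
lemma nonempty_coreflectionSequence (B : C) : Nonempty (h.CoreflectionSequence B) := by
  obtain ⟨Y, X, y, x, hY, hX, δ, hδ⟩ := h.right_res B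
  obtain ⟨S, M, m, q, hS, hM, δ', hδ'⟩ := h.left_res Y
  obtain ⟨R, d, e, t, δ'', -, -, h₁, h₂, h₃, -⟩ := T.et4_op _ _ _ _ _ _ hδ' hδ
  refine ⟨⟨R, S, d, e, ⟨M, X, t, _, ⟨hM, ?_⟩, hX, δ'', h₁⟩, hS, ⟨_, h₂⟩, ?_⟩⟩
  · refine V_of_ext_eq_zero fun U hU β => ?_
    obtain ⟨α, hα⟩ := Extriangulated.Realizes.exists_push_eq_mid hδ' β (h.ext_eq_zero _ _ hU hY _)
    rw [← hα, h.ext_eq_zero _ _ hU hS α, map_zero]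
  · intro U hU β
    obtain ⟨g, hg⟩ := Extriangulated.Realizes.exists_pull_eq hδ β (h.ext_eq_zero _ _ hU hY _)
    exact ⟨pull T.E g δ'', by rw [push_pull, h₃, hg]⟩

/-- The universal property of a reflection sequence. -/
lemma ReflectionSequence.bijective {B : C} (r : h.ReflectionSequence B) {Y : C} (hY : h.plus Y) :
    Function.Bijective fun f : h.toQuo.obj r.R ⟶ h.toQuo.obj Y => h.toQuo.map r.z ≫ f := by
  obtain ⟨V, W, v, y, hV, hW, l, hl⟩ := hY
  obtain ⟨R, S, z, p, -, hS, ⟨δ, hδ⟩, hsurj⟩ := r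
  constructor
  · intro f g hfg
    obtain ⟨f, rfl⟩ := h.toQuo.map_surjective f
    obtain ⟨g, rfl⟩ := h.toQuo.map_surjective g
    simp only [← Functor.map_comp, map_eq_iff] at hfg ⊢
    obtain ⟨M, a, b, hM, e⟩ := hfg
    obtain ⟨a', rfl⟩ := hδ.exists_desc_of_push a (h.ext_eq_zero _ _ hS hM.2 _)
    obtain ⟨s, hs⟩ := hδ.exists_desc (f - g - a' ≫ b) (by
      rw [Preadditive.comp_sub, Preadditive.comp_sub, e, Category.assoc, sub_self])
    obtain ⟨s', rfl⟩ := hl.exists_lift_of_pull s (h.ext_eq_zero _ _ hS hV _)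
    refine ⟨M ⊞ W, biprod.lift a' (p ≫ s'), biprod.desc b y,
      ⟨h.hU.biprod _ _ hM.1 hW.1, h.hV.biprod _ _ hM.2 hW.2⟩, ?_⟩
    rw [biprod.lift_desc, Category.assoc, hs]
    abel
  · intro f
    obtain ⟨f, rfl⟩ := h.toQuo.map_surjective f
    obtain ⟨β, hβ⟩ := hsurj V hV (pull T.E f l)
    have hβ' : push T.E v β = 0 := by
      obtain ⟨α, hα⟩ := hδ.exists_pull_eq_mid (push T.E v β) (by
        rw [← push_pull, hβ, push_pull, hl.push_eq_zero, map_zero])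
      rw [← hα, h.ext_eq_zero _ _ hS hW.2 α, map_zero]
    obtain ⟨g, hg⟩ := hl.exists_pull_eq β hβ'
    obtain ⟨k, hk⟩ := hl.exists_lift_of_pull (f - z ≫ g) (by
      rw [pull_sub _ T.additive_left, pull_comp, hg, hβ, sub_self])
    obtain ⟨k', rfl⟩ := hδ.exists_desc_of_push k (h.ext_eq_zero _ _ hS hW.2 _)
    refine ⟨h.toQuo.map (g + k' ≫ y), ?_⟩
    dsimp only
    rw [← Functor.map_comp]
    congr 1
    rw [Preadditive.comp_add, ← Category.assoc, hk]
    abel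

/-- The universal property of a coreflection sequence. -/
lemma CoreflectionSequence.bijective {B : C} (r : h.CoreflectionSequence B) {X : C}
    (hX : h.minus X) :
    Function.Bijective fun f : h.toQuo.obj X ⟶ h.toQuo.obj r.R => f ≫ h.toQuo.map r.z := by
  obtain ⟨W, U, y, v, hW, hU, l, hl⟩ := hX
  obtain ⟨R, S, p, z, -, hS, ⟨δ, hδ⟩, hsurj⟩ := r
  constructor
  · intro f g hfg
    obtain ⟨f, rfl⟩ := h.toQuo.map_surjective f
    obtain ⟨g, rfl⟩ := h.toQuo.map_surjective g
    simp only [← Functor.map_comp, map_eq_iff] at hfg ⊢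
    obtain ⟨M, a, b, hM, e⟩ := hfg
    obtain ⟨b', rfl⟩ := hδ.exists_lift_of_pull b (h.ext_eq_zero _ _ hM.1 hS _)
    obtain ⟨s, hs⟩ := hδ.exists_lift (f - g - a ≫ b') (by
      rw [Preadditive.sub_comp, Preadditive.sub_comp, e, Category.assoc, sub_self])
    obtain ⟨s', rfl⟩ := hl.exists_desc_of_push s (h.ext_eq_zero _ _ hU hS _)
    refine ⟨M ⊞ W, biprod.lift a y, biprod.desc b' (s' ≫ p),
      ⟨h.hU.biprod _ _ hM.1 hW.1, h.hV.biprod _ _ hM.2 hW.2⟩, ?_⟩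
    rw [biprod.lift_desc, ← Category.assoc, hs]
    abel
  · intro f
    obtain ⟨f, rfl⟩ := h.toQuo.map_surjective f
    obtain ⟨β, hβ⟩ := hsurj U hU (push T.E f l)
    have hβ' : pull T.E v β = 0 := by
      obtain ⟨α, hα⟩ := hδ.exists_push_eq_mid (pull T.E v β) (by
        rw [push_pull, hβ, ← push_pull, hl.pull_eq_zero, map_zero])
      rw [← hα, h.ext_eq_zero _ _ hW.1 hS α, map_zero]
    obtain ⟨g, hg⟩ := hl.exists_push_eq β hβ'
    obtain ⟨k, hk⟩ := hl.exists_desc_of_push (f - g ≫ z) (by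
      rw [push_sub _ T.additive_right, push_comp, hg, hβ, sub_self])
    obtain ⟨k', rfl⟩ := hδ.exists_lift_of_pull k (h.ext_eq_zero _ _ hW.1 hS _)
    refine ⟨h.toQuo.map (g + y ≫ k'), ?_⟩
    dsimp only
    rw [← Functor.map_comp]
    congr 1
    rw [Preadditive.add_comp, Category.assoc, hk]
    abel

/-- The coreflection of an object of `B⁺` belongs to `B⁺`. -/
lemma CoreflectionSequence.plus_R {B : C} (r : h.CoreflectionSequence B) (hB : h.plus B) :
    h.plus r.R := by
  obtain ⟨V, W, v, y, hV, hW, l, hl⟩ := hB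
  obtain ⟨R, S, p, z, -, hS, ⟨δ, hδ⟩, -⟩ := r
  obtain ⟨V', U', v', u', hV', hU', l', hl'⟩ := h.left_res R
  refine ⟨V', U', v', u', hV', ⟨hU', ?_⟩, l', hl'⟩
  obtain ⟨k, hk⟩ := hl.exists_lift_of_pull (u' ≫ z) (h.ext_eq_zero _ _ hU' hV _)
  refine V_of_ext_eq_zero fun X hX β => ?_
  obtain ⟨α, hα⟩ := hδ.exists_push_eq_mid (push T.E u' β) (by
    rw [← push_comp, ← hk, push_comp, h.ext_eq_zero _ _ hX hW.2 (push T.E k β), map_zero])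
  rw [h.ext_eq_zero _ _ hX hS α, map_zero] at hα
  obtain ⟨γ, hγ⟩ := Extriangulated.Realizes.exists_push_eq_mid hl' β hα.symm
  rw [← hγ, h.ext_eq_zero _ _ hX hV' γ, map_zero]

/-! ### The associated functor to the heart -/

/-- The bijection between the morphisms in `B⁺ / (U ∩ V)` out of the reflection of `B` and the
morphisms in `C / (U ∩ V)` out of `B`, given by composition with `z`. -/
def plusEquiv (ρ : ∀ B : C, h.ReflectionSequence B) (B : h.Quo) (Y : h.quoPlus.FullSubcategory) :
    ((⟨h.toQuo.obj (ρ B.as).R, (ρ B.as).plus_R⟩ : h.quoPlus.FullSubcategory) ⟶ Y) ≃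
      (B ⟶ h.quoPlus.ι.obj Y) :=
  h.quoPlus.fullyFaithfulι.homEquiv.trans
    (Equiv.ofBijective _ ((ρ B.as).bijective (Y := Y.obj.as) Y.property))

/-- The bijection between the morphisms in `B⁻ / (U ∩ V)` into the coreflection of `B` and the
morphisms in `C / (U ∩ V)` into `B`, given by composition with `z`. -/
def minusEquiv (κ : ∀ B : C, h.CoreflectionSequence B) (X : h.quoMinus.FullSubcategory)
    (B : h.Quo) :
    (X ⟶ (⟨h.toQuo.obj (κ B.as).R, (κ B.as).minus_R⟩ : h.quoMinus.FullSubcategory)) ≃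
      (h.quoMinus.ι.obj X ⟶ B) :=
  h.quoMinus.fullyFaithfulι.homEquiv.trans
    (Equiv.ofBijective _ ((κ B.as).bijective (X := X.obj.as) X.property))

lemma plusEquiv_comp (ρ : ∀ B : C, h.ReflectionSequence B) (B : h.Quo)
    (Y Y' : h.quoPlus.FullSubcategory) (g : Y ⟶ Y') (k) :
    plusEquiv ρ B Y' (k ≫ g) = plusEquiv ρ B Y k ≫ h.quoPlus.ι.map g :=
  (Category.assoc (h.toQuo.map (ρ B.as).z) k.hom g.hom).symm

lemma minusEquiv_comp (κ : ∀ B : C, h.CoreflectionSequence B)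
    (X' X : h.quoMinus.FullSubcategory) (B : h.Quo) (f : X' ⟶ X) (g) :
    minusEquiv κ X' B (f ≫ g) = h.quoMinus.ι.map f ≫ minusEquiv κ X B g :=
  Category.assoc f.hom g.hom (h.toQuo.map (κ B.as).z)

/-- The functor `σ⁺`, determined by a choice of reflection sequences: it sends `B` to its
reflection, and `f : B ⟶ B'` to the unique morphism compatible with `f` and the reflections. -/
def sigmaPlus (ρ : ∀ B : C, h.ReflectionSequence B) : h.Quo ⥤ h.quoPlus.FullSubcategory :=
  Adjunction.leftAdjointOfEquiv (G := h.quoPlus.ι) (plusEquiv ρ) (plusEquiv_comp ρ)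

/-- `σ⁺` is left adjoint to the inclusion. -/
def sigmaPlusAdj (ρ : ∀ B : C, h.ReflectionSequence B) : sigmaPlus ρ ⊣ h.quoPlus.ι :=
  Adjunction.adjunctionOfEquivLeft (plusEquiv ρ) (plusEquiv_comp ρ)

/-- The functor `σ⁻`, determined by a choice of coreflection sequences: it sends `B` to its
coreflection, and `f : B ⟶ B'` to the unique morphism compatible with `f` and the
coreflections. -/
def sigmaMinus (κ : ∀ B : C, h.CoreflectionSequence B) : h.Quo ⥤ h.quoMinus.FullSubcategory :=
  Adjunction.rightAdjointOfEquiv (F := h.quoMinus.ι) (fun X B => (minusEquiv κ X B).symm)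
    fun X' X B f g => by
      rw [Equiv.symm_apply_eq, minusEquiv_comp, Equiv.apply_symm_apply]

/-- `σ⁻` is right adjoint to the inclusion. -/
def sigmaMinusAdj (κ : ∀ B : C, h.CoreflectionSequence B) : h.quoMinus.ι ⊣ sigmaMinus κ :=
  Adjunction.adjunctionOfEquivRight (fun X B => (minusEquiv κ X B).symm)
    fun X' X B f g => by
      rw [Equiv.symm_apply_eq, minusEquiv_comp, Equiv.apply_symm_apply]

/-- The associated functor `H = σ⁻ ∘ σ⁺ ∘ π` from `C` to the heart. -/
def H (ρ : ∀ B : C, h.ReflectionSequence B) (κ : ∀ B : C, h.CoreflectionSequence B) :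
    C ⥤ h.Heart :=
  h.quoHeart.lift
    (h.toQuo ⋙ sigmaPlus ρ ⋙ h.quoPlus.ι ⋙ sigmaMinus κ ⋙ h.quoMinus.ι)
    fun B => ⟨(κ _).plus_R (ρ B).plus_R, (κ _).minus_R⟩

end CotorsionPair

end ExtriCat

end

noncomputable section

namespace ExtriCat

variable {C : Type u} [Category.{v} C] [Preadditive C] [HasZeroObject C] [HasBinaryBiproducts C]
  {T : Extriangulated.{w} C}

/-! Everything is done with actual conflations in the extriangulated category; the quotient by the
core enters only through vanishing of `𝔼` between `U` and `V`. The basic device is a duality of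
obstructions: given `A ⟶ B ⟶ Z` realizing `δ` and `Z ⟶ M ⟶ S` realizing `μ`, the extension `δ`
extends along `Z ⟶ M` if and only if `μ` lifts along `B ⟶ Z` (`exists_push_eq_of_pull`,
`exists_pull_eq_of_push`). Both directions are readings of (ET4) or its dual. Gluing of extensions
over pushouts and pullbacks follows.

The heart is abelian. The cokernel of `f` is obtained by pushing out a conflation `A ⟶ W ⟶ U` along
`f` and reflecting the result; kernels are dual. If `f` is a monomorphism, pulling back `V ⟶ W ⟶ B`
along `f` gives a middle term in `V` (`V_of_mono`). Then `f` is, up to sign and core objects, a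
deflation `P ⟶ B` with kernel in `V`, whose extension class extends along the cokernel map. A
morphism killed by the cokernel therefore lifts through `f`, so `f` is a kernel.

The functor is cohomological. A short pair is a deflation with kernel in `V` followed by an
inflation with cone in `U`, the class of the first extending along the second. Reflections and
coreflections can be chosen so as to preserve short pairs (`ShortPair.exists_reflection`,
`ShortPair.exists_coreflection`), so `H` sends them to a monomorphism and an epimorphism, the first
being the kernel of the second as soon as the composite vanishes (`ShortPair.map_H`). For a
conflation with maps `x`, `y`, write `x = q ≫ b` and `y = b' ≫ q'` with `b`, `b'` a short pair,
`H(q)` epi and `H(q')` mono. This reduces exactness at `B` to the short pair. -/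

lemma pull_zero {C : Type u} [Category.{v} C] [Preadditive C] (E : Cᵒᵖ ⥤ C ⥤ AddCommGrpCat.{w})
    (hE : E.Additive) {Z Z' A : C}
    (δ : Ext E Z A) : pull E (0 : Z' ⟶ Z) δ = 0 := by
  rw [← sub_self (0 : Z' ⟶ Z), pull_sub E hE, sub_self]

lemma push_zero {C : Type u} [Category.{v} C] [Preadditive C] (E : Cᵒᵖ ⥤ C ⥤ AddCommGrpCat.{w})
    (hE : ∀ X, (E.obj X).Additive) {Z A A' : C}
    (δ : Ext E Z A) : push E (0 : A ⟶ A') δ = 0 := by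
  rw [← sub_self (0 : A ⟶ A'), push_sub E hE, sub_self]

lemma pull_add {C : Type u} [Category.{v} C] [Preadditive C] (E : Cᵒᵖ ⥤ C ⥤ AddCommGrpCat.{w})
    (hE : E.Additive) {Z Z' A : C} (c d : Z' ⟶ Z) (δ : Ext E Z A) :
    pull E (c + d) δ = pull E c δ + pull E d δ := by
  simp [pull]

lemma push_add {C : Type u} [Category.{v} C] [Preadditive C] (E : Cᵒᵖ ⥤ C ⥤ AddCommGrpCat.{w})
    (hE : ∀ X, (E.obj X).Additive) {Z A A' : C} (c d : A ⟶ A') (δ : Ext E Z A) :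
    push E (c + d) δ = push E c δ + push E d δ := by
  have := hE (op Z)
  simp [push, Functor.map_add]

/-! ### Realizations: isomorphisms, the lifting duality, pushouts and pullbacks -/

namespace Extriangulated

variable {A B Z : C} {δ : Ext T.E Z A} {x : A ⟶ B} {y : B ⟶ Z}

lemma realizes_inr_fst (A Z : C) :
    T.Realizes (0 : Ext T.E A Z) (biprod.inr : Z ⟶ A ⊞ Z) (biprod.fst : A ⊞ Z ⟶ A) :=
  (T.s_zero Z A).trans (classOf_eq_of_iso (biprod.braiding Z A) (by ext <;> simp) (by simp))

lemma realizes_inl_snd (A Z : C) :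
    T.Realizes (0 : Ext T.E Z A) (biprod.inl : A ⟶ A ⊞ Z) (biprod.snd : A ⊞ Z ⟶ Z) :=
  T.s_zero A Z

namespace Realizes

lemma exists_iso (h : T.Realizes δ x y) {B' : C} {x' : A ⟶ B'} {y' : B' ⟶ Z}
    (h' : T.Realizes δ x' y') : ∃ b : B ≅ B', x ≫ b.hom = x' ∧ b.hom ≫ y' = y :=
  Quotient.exact (Eq.trans (Eq.symm h) h')

lemma of_iso (h : T.Realizes δ x y) {B' : C} {x' : A ⟶ B'} {y' : B' ⟶ Z} (b : B ≅ B')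
    (h₁ : x ≫ b.hom = x') (h₂ : b.hom ≫ y' = y) : T.Realizes δ x' y' :=
  Eq.trans h (classOf_eq_of_iso b h₁ h₂)

/-- The difference `b - 𝟙 B` factors through `y` and is killed by `y`, so it squares to zero and `b`
is unipotent. -/
lemma isIso_of_endo (h : T.Realizes δ x y) (b : B ⟶ B) (h₁ : x ≫ b = x) (h₂ : b ≫ y = y) :
    IsIso b := by
  obtain ⟨g, hg⟩ := h.exists_desc (b - 𝟙 B) (by simp [h₁])
  have h₃ : (b - 𝟙 B) ≫ (b - 𝟙 B) = 0 := by
    rw [← hg, ← Category.assoc, hg, Preadditive.sub_comp, h₂, Category.id_comp, sub_self, zero_comp]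
  have h₄ : b ≫ b - b - (b - 𝟙 B) = 0 := by simpa using h₃
  refine ⟨𝟙 B - (b - 𝟙 B), ?_, ?_⟩
  · rw [Preadditive.comp_sub, Preadditive.comp_sub, Category.comp_id, ← sub_eq_zero, ← neg_eq_zero,
      ← h₄]
    abel
  · rw [Preadditive.sub_comp, Preadditive.sub_comp, Category.id_comp, ← sub_eq_zero,
      ← neg_eq_zero, ← h₄]
    abel

/-- The morphisms induced on middle terms are not unique, so the two induced by an isomorphism and
its inverse need not be mutually inverse. Their composites are nevertheless automorphisms, which
suffices. -/
lemma exists_iso_of_iso (h : T.Realizes δ x y) {A' Z' B' : C} {δ' : Ext T.E Z' A'} {x' : A' ⟶ B'}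
    {y' : B' ⟶ Z'} (h' : T.Realizes δ' x' y') (a : A ≅ A') (c : Z ≅ Z')
    (hac : push T.E a.hom δ = pull T.E c.hom δ') :
    ∃ b : B ≅ B', x ≫ b.hom = a.hom ≫ x' ∧ y ≫ c.hom = b.hom ≫ y' := by
  have hac' : push T.E a.inv δ' = pull T.E c.inv δ := by
    rw [← pull_id T.E δ', ← c.inv_hom_id, pull_comp, ← hac, push_pull, ← push_comp, a.hom_inv_id,
      push_id]
  obtain ⟨b, h₁, h₂⟩ := T.realize _ _ _ _ _ _ h h' a.hom c.hom hac
  obtain ⟨b', h₁', h₂'⟩ := T.realize _ _ _ _ _ _ h' h a.inv c.inv hac'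
  have i₁ := h.isIso_of_endo (b ≫ b')
    (by rw [← Category.assoc, h₁, Category.assoc, h₁', a.hom_inv_id_assoc])
    (by rw [Category.assoc, ← h₂', ← Category.assoc, ← h₂, Category.assoc, c.hom_inv_id,
      Category.comp_id])
  have i₂ := h'.isIso_of_endo (b' ≫ b)
    (by rw [← Category.assoc, h₁', Category.assoc, h₁, a.inv_hom_id_assoc])
    (by rw [Category.assoc, ← h₂, ← Category.assoc, ← h₂', Category.assoc, c.inv_hom_id,
      Category.comp_id])
  have : IsSplitMono b := ⟨⟨b' ≫ inv (b ≫ b'), by rw [← Category.assoc, IsIso.hom_inv_id]⟩⟩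
  have : IsSplitEpi b := ⟨⟨inv (b' ≫ b) ≫ b', by rw [Category.assoc, IsIso.inv_hom_id]⟩⟩
  have : IsIso b := isIso_of_epi_of_isSplitMono b
  exact ⟨asIso b, h₁, h₂⟩

/-- Realizations are stable under isomorphisms of the ends. -/
lemma push_pull_iso (h : T.Realizes δ x y) {A' Z' : C} (a : A ≅ A') (c : Z' ≅ Z) :
    T.Realizes (push T.E a.hom (pull T.E c.hom δ)) (a.inv ≫ x) (y ≫ c.inv) := by
  obtain ⟨B', x', y', h'⟩ := T.exists_realizes (push T.E a.hom (pull T.E c.hom δ))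
  obtain ⟨b, h₁, h₂⟩ := h.exists_iso_of_iso h' a c.symm (by
    rw [← push_pull, ← pull_comp, Iso.symm_hom, c.inv_hom_id, pull_id])
  exact h'.of_iso b.symm (by
    rw [Iso.symm_hom, Iso.comp_inv_eq, Category.assoc, h₁, a.inv_hom_id_assoc]) (by
    rw [Iso.symm_hom, Iso.inv_comp_eq, ← h₂, Iso.symm_hom])

lemma push_iso (h : T.Realizes δ x y) {A' : C} (a : A ≅ A') :
    T.Realizes (push T.E a.hom δ) (a.inv ≫ x) y := by
  simpa [pull_id] using h.push_pull_iso a (Iso.refl _)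

lemma pull_iso (h : T.Realizes δ x y) {Z' : C} (c : Z' ≅ Z) :
    T.Realizes (pull T.E c.hom δ) x (y ≫ c.inv) := by
  simpa [push_id] using h.push_pull_iso (Iso.refl _) c

/-- An extension `ε` of `B` by `A` lifted along an inflation `m : B ⟶ M` allows to lift the
extension realized by `m` to the middle term of `ε`. -/
lemma exists_push_eq_of_pull (h : T.Realizes δ x y) {M S : C} {μ : Ext T.E S Z} {m : Z ⟶ M}
    {p : M ⟶ S} (hμ : T.Realizes μ m p) {ε : Ext T.E M A} (hε : pull T.E m ε = δ) :
    ∃ ν : Ext T.E S B, push T.E y ν = μ := by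
  obtain ⟨N, j, n, hN⟩ := T.exists_realizes ε
  obtain ⟨Y, d, e, -, ν, -, -, -, h₁, h₂, -⟩ := T.et4_op _ _ _ _ _ _ hN hμ
  obtain ⟨b, -, hb⟩ := Realizes.exists_iso (T := T) h₁ (hε.symm ▸ h)
  exact ⟨push T.E b.hom ν, by rw [← push_comp, hb, h₂]⟩

/-- The converse of `exists_push_eq_of_pull`: (ET4) for the composite of `x` with the inflation
realizing `ν` produces an extension over an object identified with `M`, both realizing `μ`. -/
lemma exists_pull_eq_of_push (h : T.Realizes δ x y) {M S : C} {μ : Ext T.E S Z} {m : Z ⟶ M}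
    {p : M ⟶ S} (hμ : T.Realizes μ m p) {ν : Ext T.E S B} (hν : push T.E y ν = μ) :
    ∃ ε : Ext T.E M A, pull T.E m ε = δ := by
  obtain ⟨N, j, n, hN⟩ := T.exists_realizes ν
  obtain ⟨Y, d, e, -, ε, -, -, -, h₁, h₂, -⟩ := T.et4 _ _ _ _ _ _ h hN
  obtain ⟨b, hb, -⟩ := Realizes.exists_iso (T := T) (hν.symm ▸ hμ) h₁
  exact ⟨pull T.E b.hom ε, by rw [← pull_comp, hb, h₂]⟩

/-- Extensions of `A'` which agree on `A` with an extension of `B` extend to the pushout. -/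
lemma exists_pull_eq_of_pushout (h : T.Realizes δ x y) {A' P : C} {u : A ⟶ A'} {p : A' ⟶ P}
    {q : P ⟶ Z} (hP : T.Realizes (push T.E u δ) p q) {Y : C} (α : Ext T.E A' Y)
    (β : Ext T.E B Y) (hαβ : pull T.E u α = pull T.E x β) :
    ∃ π : Ext T.E P Y, pull T.E p π = α := by
  obtain ⟨N, i, n, hN⟩ := T.exists_realizes α
  obtain ⟨N', i', n', hN'⟩ := T.exists_realizes (pull T.E u α)
  obtain ⟨t, -, ht⟩ := T.realize _ _ _ _ _ _ hN' hN (𝟙 Y) u (push_id _ _)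
  -- Extending `α` along `p` amounts to lifting `push u δ` along `n`. The hypothesis says that `pull
  -- u α` extends along `x`, which gives a lift of `δ` itself to `N'`; `t` carries it to `N`.
  obtain ⟨ν, hν⟩ := hN'.exists_push_eq_of_pull h hαβ.symm
  exact hN.exists_pull_eq_of_push hP (ν := push T.E t ν) (by
    rw [← push_comp, ← ht, push_comp, hν])

/-- Extensions by `B'` which agree over `Z` with an extension by `B` lift to the pullback. -/
lemma exists_push_eq_of_pullback (h : T.Realizes δ x y) {B' P : C} {v : B' ⟶ Z} {q : A ⟶ P}
    {p : P ⟶ B'} (hP : T.Realizes (pull T.E v δ) q p) {X : C} (α : Ext T.E X B')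
    (β : Ext T.E X B) (hαβ : push T.E v α = push T.E y β) :
    ∃ π : Ext T.E X P, push T.E p π = α := by
  obtain ⟨N, i, n, hN⟩ := T.exists_realizes α
  obtain ⟨N', i', n', hN'⟩ := T.exists_realizes (push T.E v α)
  obtain ⟨t, ht, -⟩ := T.realize _ _ _ _ _ _ hN hN' v (𝟙 X) (pull_id _ _).symm
  obtain ⟨ε, hε⟩ := h.exists_pull_eq_of_push hN' hαβ.symm
  exact hP.exists_push_eq_of_pull hN (ε := pull T.E t ε) (by
    rw [← pull_comp, ht, pull_comp, hε])

/-- When the quotient `Z` splits as `S` and `S'`, the restriction of `δ` to `S` sits inside `B` with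
quotient `S'`, and the splitting identifies the class of this new conflation. It serves to compare
`δ` with its components when `Z` is a biproduct. -/
lemma exists_of_split_snd (h : T.Realizes δ x y) {A' S S' : C} {j : S ⟶ Z} {g : Z ⟶ S'}
    {t : S' ⟶ Z} (hj : T.Realizes 0 j g) (ht : t ≫ g = 𝟙 S') {u : A ⟶ A'} {v : A' ⟶ S}
    (hu : T.Realizes (pull T.E j δ) u v) :
    ∃ p : A' ⟶ B, u ≫ p = x ∧ p ≫ y = v ≫ j ∧
      T.Realizes (push T.E u (pull T.E t δ)) p (y ≫ g) := by
  obtain ⟨Y, d, e, k, ν, hk, hd, h₁, h₂, -, h₃⟩ := T.et4_op _ _ _ _ _ _ h hj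
  obtain ⟨b, hb, hb'⟩ := Realizes.exists_iso (T := T) h₂ hu
  have hν : push T.E b.hom ν = push T.E u (pull T.E t δ) := by
    rw [push_pull, ← hb, push_comp, ← h₃, push_pull, ← pull_comp, ht, pull_id]
  refine ⟨b.inv ≫ k, by rw [← hb, Category.assoc, b.hom_inv_id_assoc, hd],
    by rw [Category.assoc, ← hk, ← hb', Category.assoc, b.inv_hom_id_assoc], ?_⟩
  rw [← hν]
  exact Realizes.push_iso (T := T) h₁ b

lemma exists_of_split_fst (h : T.Realizes δ x y) {Z' S S' : C} {j : S ⟶ A} {g : A ⟶ S'}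
    {t : A ⟶ S} (hj : T.Realizes 0 j g) (ht : j ≫ t = 𝟙 S) {u : S' ⟶ Z'} {v : Z' ⟶ Z}
    (hu : T.Realizes (push T.E g δ) u v) :
    ∃ p : B ⟶ Z', p ≫ v = y ∧ x ≫ p = g ≫ u ∧
      T.Realizes (pull T.E v (push T.E t δ)) (j ≫ x) p := by
  obtain ⟨Y, d, e, k, ν, hk, hd, h₁, h₂, -, h₃⟩ := T.et4 _ _ _ _ _ _ hj h
  obtain ⟨b, hb, hb'⟩ := Realizes.exists_iso (T := T) h₂ hu
  have hν : pull T.E b.inv ν = pull T.E v (push T.E t δ) := by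
    rw [(Iso.eq_inv_comp b).2 hb', pull_comp, ← push_pull, ← h₃, ← push_comp, ht, push_id]
  refine ⟨k ≫ b.hom, by rw [Category.assoc, hb', hd],
    by rw [← Category.assoc, ← hk, Category.assoc, hb], ?_⟩
  rw [← hν]
  simpa using Realizes.pull_iso (T := T) h₁ b.symm

/-- The pushout of two conflations starting at the same object. -/
lemma exists_pushout (h : T.Realizes δ x y) {A' S : C} {γ : Ext T.E S A} {u : A ⟶ A'}
    {v : A' ⟶ S} (hγ : T.Realizes γ u v) :
    ∃ (P : C) (p : A' ⟶ P) (q : P ⟶ Z) (b : B ⟶ P) (d : P ⟶ S),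
      T.Realizes (push T.E u δ) p q ∧ T.Realizes (push T.E x γ) b d ∧
      x ≫ b = u ≫ p ∧ b ≫ q = y ∧ p ≫ d = v ∧ pull T.E q δ + pull T.E d γ = 0 := by
  -- The pushout is the middle term of the extension of `Z ⊞ S` by `A` with components `δ` and `γ`.
  -- Splitting off either summand gives one of the two conflations, and the final relation is the
  -- vanishing of an extension pulled back to its own middle term.
  obtain ⟨P, k, r, hP⟩ := T.exists_realizes (pull T.E biprod.fst δ + pull T.E biprod.snd γ)
  have h₁ : pull T.E biprod.inl (pull T.E biprod.fst δ + pull T.E biprod.snd γ) = δ := by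
    rw [map_add, ← pull_comp, ← pull_comp, biprod.inl_fst, biprod.inl_snd, pull_id,
      pull_zero _ T.additive_left, add_zero]
  have h₂ : pull T.E biprod.inr (pull T.E biprod.fst δ + pull T.E biprod.snd γ) = γ := by
    rw [map_add, ← pull_comp, ← pull_comp, biprod.inr_fst, biprod.inr_snd, pull_id,
      pull_zero _ T.additive_left, zero_add]
  obtain ⟨p, hp, hp', hp''⟩ := hP.exists_of_split_snd (realizes_inr_fst _ _)
    (t := biprod.inl) (by simp) (h₂.symm ▸ hγ)
  obtain ⟨b, hb, hb', hb''⟩ := hP.exists_of_split_snd (realizes_inl_snd _ _)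
    (t := biprod.inr) (by simp) (h₁.symm ▸ h)
  rw [h₁] at hp''
  rw [h₂] at hb''
  refine ⟨P, p, r ≫ biprod.fst, b, r ≫ biprod.snd, hp'', hb'', by rw [hp, hb],
    by rw [reassoc_of% hb']; simp, by rw [reassoc_of% hp']; simp, ?_⟩
  rw [pull_comp, pull_comp, ← map_add, hP.pull_eq_zero]

/-- The pullback of two conflations ending at the same object. -/
lemma exists_pullback (h : T.Realizes δ x y) {Z' S : C} {γ : Ext T.E Z S} {u : S ⟶ Z'}
    {v : Z' ⟶ Z} (hγ : T.Realizes γ u v) :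
    ∃ (P : C) (q : A ⟶ P) (p : P ⟶ Z') (d : S ⟶ P) (b : P ⟶ B),
      T.Realizes (pull T.E v δ) q p ∧ T.Realizes (pull T.E y γ) d b ∧
      b ≫ y = p ≫ v ∧ q ≫ b = x ∧ d ≫ p = u ∧ push T.E q δ + push T.E d γ = 0 := by
  obtain ⟨P, r, k, hP⟩ := T.exists_realizes (push T.E biprod.inl δ + push T.E biprod.inr γ)
  have h₁ : push T.E biprod.fst (push T.E biprod.inl δ + push T.E biprod.inr γ) = δ := by
    rw [map_add, ← push_comp, ← push_comp, biprod.inl_fst, biprod.inr_fst, push_id,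
      push_zero _ T.additive_right, add_zero]
  have h₂ : push T.E biprod.snd (push T.E biprod.inl δ + push T.E biprod.inr γ) = γ := by
    rw [map_add, ← push_comp, ← push_comp, biprod.inl_snd, biprod.inr_snd, push_id,
      push_zero _ T.additive_right, zero_add]
  obtain ⟨p, hp, hp', hp''⟩ := hP.exists_of_split_fst (realizes_inl_snd _ _)
    (t := biprod.fst) (by simp) (h₂.symm ▸ hγ)
  obtain ⟨b, hb, hb', hb''⟩ := hP.exists_of_split_fst (realizes_inr_fst _ _)
    (t := biprod.snd) (by simp) (h₁.symm ▸ h)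
  rw [h₁] at hp''
  rw [h₂] at hb''
  refine ⟨P, biprod.inl ≫ r, p, biprod.inr ≫ r, b, hp'', hb'', by rw [hp, hb],
    by rw [Category.assoc, hb']; simp, by rw [Category.assoc, hp']; simp, ?_⟩
  rw [push_comp, push_comp, ← map_add, hP.push_eq_zero]

end Realizes

end Extriangulated

namespace CotorsionPair

variable {h : CotorsionPair T}

open Extriangulated.Realizes

instance toQuo_additive : h.toQuo.Additive :=
  Quotient.functor_additive h.rel fun _ _ _ _ _ _ => h.rel_add

lemma map_eq_zero_iff {X Y : C} (f : X ⟶ Y) :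
    h.toQuo.map f = 0 ↔ ∃ (M : C) (a : X ⟶ M) (b : M ⟶ Y), h.core M ∧ f = a ≫ b := by
  rw [← h.toQuo.map_zero, map_eq_iff]
  simp only [rel, sub_zero]

lemma map_comp_eq_zero {X M Y : C} (hM : h.core M) (a : X ⟶ M) (b : M ⟶ Y) :
    h.toQuo.map (a ≫ b) = 0 :=
  (map_eq_zero_iff _).2 ⟨M, a, b, hM, rfl⟩

/-! ### Closure properties of `U`, `V`, `B⁺`, `B⁻` and vanishing modulo the core -/

section Closure

variable {A B Z : C} {δ : Ext T.E Z A} {x : A ⟶ B} {y : B ⟶ Z}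

lemma U_of_realizes (hδ : T.Realizes δ x y) (hA : h.U A) (hZ : h.U Z) : h.U B :=
  U_of_ext_eq_zero fun V hV β => by
    obtain ⟨α, hα⟩ := hδ.exists_pull_eq_mid β (h.ext_eq_zero _ _ hA hV _)
    rw [← hα, h.ext_eq_zero _ _ hZ hV α, map_zero]

lemma V_of_realizes (hδ : T.Realizes δ x y) (hA : h.V A) (hZ : h.V Z) : h.V B :=
  V_of_ext_eq_zero fun U hU β => by
    obtain ⟨α, hα⟩ := hδ.exists_push_eq_mid β (h.ext_eq_zero _ _ hU hZ _)
    rw [← hα, h.ext_eq_zero _ _ hU hA α, map_zero]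

/-- In any conflation `V' ⟶ U' ⟶ B` the term `U'` is shown to be in the core: `U' ⟶ B ⟶ Z` lifts
through a core object, so for `X` in `U` the map `𝔼(X, U') ⟶ 𝔼(X, B)` lands in the image of `𝔼(X, A)
= 0`, while its kernel comes from `𝔼(X, V') = 0`. -/
lemma plus_mid_of_realizes (hδ : T.Realizes δ x y) (hA : h.V A) (hZ : h.plus Z) : h.plus B := by
  obtain ⟨V, W, v, w, hV, hW, l, hl⟩ := hZ
  obtain ⟨V', U', v', u', hV', hU', l', hl'⟩ := h.left_res B
  refine ⟨V', U', v', u', hV', ⟨hU', ?_⟩, l', hl'⟩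
  obtain ⟨k, hk⟩ := hl.exists_lift_of_pull (u' ≫ y) (h.ext_eq_zero _ _ hU' hV _)
  refine V_of_ext_eq_zero fun X hX β => ?_
  obtain ⟨α, hα⟩ := hδ.exists_push_eq_mid (push T.E u' β) (by
    rw [← push_comp, ← hk, push_comp, h.ext_eq_zero _ _ hX hW.2 (push T.E k β), map_zero])
  rw [h.ext_eq_zero _ _ hX hA α, map_zero] at hα
  obtain ⟨γ, hγ⟩ := Extriangulated.Realizes.exists_push_eq_mid hl' β hα.symm
  rw [← hγ, h.ext_eq_zero _ _ hX hV' γ, map_zero]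

lemma minus_mid_of_realizes (hδ : T.Realizes δ x y) (hA : h.minus A) (hZ : h.U Z) :
    h.minus B := by
  obtain ⟨W, U, w, u, hW, hU, l, hl⟩ := hA
  obtain ⟨V', U', v', u', hV', hU', l', hl'⟩ := h.right_res B
  refine ⟨V', U', v', u', ⟨?_, hV'⟩, hU', l', hl'⟩
  obtain ⟨k, hk⟩ := hl.exists_desc_of_push (x ≫ v') (h.ext_eq_zero _ _ hU hV' _)
  refine U_of_ext_eq_zero fun X hX β => ?_
  obtain ⟨α, hα⟩ := hδ.exists_pull_eq_mid (pull T.E v' β) (by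
    rw [← pull_comp, ← hk, pull_comp, h.ext_eq_zero _ _ hW.1 hX (pull T.E k β), map_zero])
  rw [h.ext_eq_zero _ _ hZ hX α, map_zero] at hα
  obtain ⟨γ, hγ⟩ := Extriangulated.Realizes.exists_pull_eq_mid hl' β hα.symm
  rw [← hγ, h.ext_eq_zero _ _ hU' hX γ, map_zero]

/-- Composing the deflation `W ⟶ B` with `y` gives a deflation onto `Z` whose kernel is an extension
of two objects of `V`. -/
lemma plus_right_of_realizes (hδ : T.Realizes δ x y) (hA : h.V A) (hB : h.plus B) :
    h.plus Z := by
  obtain ⟨V, W, v, w, hV, hW, l, hl⟩ := hB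
  obtain ⟨Y, d, e, t, δ'', -, -, h₁, h₂, -⟩ := T.et4_op _ _ _ _ _ _ hl hδ
  exact ⟨Y, W, t, _, V_of_realizes h₂ hV hA, hW, _, h₁⟩

lemma minus_left_of_realizes (hδ : T.Realizes δ x y) (hZ : h.U Z) (hB : h.minus B) :
    h.minus A := by
  obtain ⟨W, U, w, u, hW, hU, l, hl⟩ := hB
  obtain ⟨Y, d, e, t, δ'', -, -, h₁, h₂, -⟩ := T.et4 _ _ _ _ _ _ hδ hl
  exact ⟨W, Y, _, t, hW, U_of_realizes h₂ hZ hU, _, h₁⟩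

/-- An inflation with cone in `U` is an epimorphism modulo the core as seen from `B⁺`: after
correcting `f` by a map through the core it factors through `Z`, and maps from `U` to `B⁺` factor
through the core. -/
lemma map_eq_zero_of_realizes_left (hδ : T.Realizes δ x y) (hZ : h.U Z) {Y : C} (hY : h.plus Y)
    (f : B ⟶ Y) (hf : h.toQuo.map (x ≫ f) = 0) : h.toQuo.map f = 0 := by
  obtain ⟨V, W, v, w, hV, hW, l, hl⟩ := hY
  obtain ⟨M, a, b, hM, e⟩ := (map_eq_zero_iff _).1 hf
  obtain ⟨a', rfl⟩ := hδ.exists_desc_of_push a (h.ext_eq_zero _ _ hZ hM.2 _)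
  obtain ⟨s, hs⟩ := hδ.exists_desc (f - a' ≫ b) (by
    rw [Preadditive.comp_sub, e, Category.assoc, sub_self])
  obtain ⟨s', rfl⟩ := hl.exists_lift_of_pull s (h.ext_eq_zero _ _ hZ hV _)
  rw [← sub_add_cancel f (a' ≫ b), ← hs, Functor.map_add, ← Category.assoc,
    map_comp_eq_zero hW, map_comp_eq_zero hM, add_zero]

lemma map_eq_zero_of_realizes_right (hδ : T.Realizes δ x y) (hA : h.V A) {X : C}
    (hX : h.minus X) (f : X ⟶ B) (hf : h.toQuo.map (f ≫ y) = 0) : h.toQuo.map f = 0 := by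
  obtain ⟨W, U, w, u, hW, hU, l, hl⟩ := hX
  obtain ⟨M, a, b, hM, e⟩ := (map_eq_zero_iff _).1 hf
  obtain ⟨b', rfl⟩ := hδ.exists_lift_of_pull b (h.ext_eq_zero _ _ hM.1 hA _)
  obtain ⟨s, hs⟩ := hδ.exists_lift (f - a ≫ b') (by
    rw [Preadditive.sub_comp, e, Category.assoc, sub_self])
  obtain ⟨s', rfl⟩ := hl.exists_desc_of_push s (h.ext_eq_zero _ _ hU hA _)
  rw [← sub_add_cancel f (a ≫ b'), ← hs, Functor.map_add, Category.assoc,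
    map_comp_eq_zero hW, map_comp_eq_zero hM, add_zero]

/-- If `g ≫ m` factors through the core, then `pull g δ` factors through some `𝔼(W, A) = 0`. The
resulting lift is an honest one, not merely modulo the core. -/
lemma exists_lift_of_map_comp_eq_zero (hδ : T.Realizes δ x y) (hA : h.V A) {M : C} (m : Z ⟶ M)
    {ε : Ext T.E M A} (hε : pull T.E m ε = δ) {X : C} (g : X ⟶ Z)
    (hg : h.toQuo.map (g ≫ m) = 0) : ∃ k : X ⟶ B, k ≫ y = g := by
  obtain ⟨W, a, b, hW, e⟩ := (map_eq_zero_iff _).1 hg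
  exact hδ.exists_lift_of_pull g (by
    rw [← hε, ← pull_comp, e, pull_comp, h.ext_eq_zero _ _ hW.1 hA (pull T.E b ε), map_zero])

lemma exists_desc_of_map_comp_eq_zero (hδ : T.Realizes δ x y) (hZ : h.U Z) {M : C} (m : M ⟶ A)
    {ν : Ext T.E Z M} (hν : push T.E m ν = δ) {X : C} (g : A ⟶ X)
    (hg : h.toQuo.map (m ≫ g) = 0) : ∃ k : B ⟶ X, x ≫ k = g := by
  obtain ⟨W, a, b, hW, e⟩ := (map_eq_zero_iff _).1 hg
  exact hδ.exists_desc_of_push g (by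
    rw [← hν, ← push_comp, e, push_comp, h.ext_eq_zero _ _ hZ hW.2 (push T.E a ν), map_zero])

end Closure

/-- The reflection of an object of `B⁻` belongs to `B⁻`. -/
lemma ReflectionSequence.minus_R {B : C} (r : h.ReflectionSequence B) (hB : h.minus B) :
    h.minus r.R :=
  minus_mid_of_realizes r.conflation.choose_spec hB r.U_S

/-! ### Short pairs and their stability under reflection and coreflection -/

variable (h) in
/-- A pair `A ⟶ B ⟶ M` is short if it comes from conflations `S ⟶ A ⟶ B` and `B ⟶ M ⟶ S'` with
`S ∈ V` and `S' ∈ U` such that the first one extends along `B ⟶ M`. -/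
def ShortPair {A B M : C} (a : A ⟶ B) (m : B ⟶ M) : Prop :=
  ∃ (S S' : C) (i : S ⟶ A) (p : M ⟶ S') (ε : Ext T.E B S) (μ : Ext T.E S' B),
    h.V S ∧ h.U S' ∧ T.Realizes ε i a ∧ T.Realizes μ m p ∧ ∃ ε' : Ext T.E M S, pull T.E m ε' = ε

lemma ShortPair.exists_reflection {A B M : C} {a : A ⟶ B} {m : B ⟶ M} (H : h.ShortPair a m) :
    ∃ (rA : h.ReflectionSequence A) (rB : h.ReflectionSequence B) (rM : h.ReflectionSequence M)
      (a' : rA.R ⟶ rB.R) (m' : rB.R ⟶ rM.R), h.ShortPair a' m' ∧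
      rA.z ≫ a' = a ≫ rB.z ∧ rB.z ≫ m' = m ≫ rM.z := by
  obtain ⟨V, U, i, p, ε, μ, hV, hU, hε, hμ, ε', hε'⟩ := H
  obtain ⟨rA⟩ := nonempty_reflectionSequence (h := h) A
  obtain ⟨σ, hσ⟩ := rA.conflation
  -- Pushing the reflection of `A` out along `a` gives a reflection of `B`, with the kernel of `a`
  -- unchanged and `ε` extended to `η`.
  obtain ⟨Y, d, e, k, η, hk, -, h₁, h₂, h₃, -⟩ := T.et4 _ _ _ _ _ _ hε hσ
  have surjB : ∀ S : C, h.V S → Function.Surjective (pull T.E d : Ext T.E Y S → Ext T.E B S) := by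
    intro S hS β
    obtain ⟨α, hα⟩ := rA.surjective S hS (pull T.E a β)
    exact hσ.exists_pull_eq_of_pushout h₂ β α hα.symm
  let rB : h.ReflectionSequence B :=
    ⟨Y, rA.S, d, e, plus_right_of_realizes h₁ hV rA.plus_R, rA.U_S, ⟨_, h₂⟩, surjB⟩
  obtain ⟨P, b, q, b', q', hb, hb', hbb', -, -, -⟩ :=
    Extriangulated.Realizes.exists_pushout hμ h₂
  -- The pushout `P` of `M` and `Y` under `B` need not lie in `B⁺`, so it is reflected once more.
  -- The cones of `M ⟶ rP.R` and `Y ⟶ rP.R` are still in `U`, being extensions of objects of `U`.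
  obtain ⟨rP⟩ := nonempty_reflectionSequence (h := h) P
  obtain ⟨τ, hτ⟩ := rP.conflation
  obtain ⟨M₁, d₁, e₁, k₁, η₁, -, -, h₁', h₂', -⟩ := T.et4 _ _ _ _ _ _ hb' hτ
  obtain ⟨M₂, d₂, e₂, k₂, η₂, -, -, h₁'', h₂'', -⟩ := T.et4 _ _ _ _ _ _ hb hτ
  have surjM : ∀ S : C, h.V S →
      Function.Surjective (pull T.E (b' ≫ rP.z) : Ext T.E rP.R S → Ext T.E M S) := by
    intro S hS β
    obtain ⟨α, hα⟩ := surjB S hS (pull T.E m β)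
    obtain ⟨π, hπ⟩ := Extriangulated.Realizes.exists_pull_eq_of_pushout h₂ hb' β α hα.symm
    obtain ⟨ρ, hρ⟩ := rP.surjective S hS π
    exact ⟨ρ, by rw [pull_comp, hρ, hπ]⟩
  let rM : h.ReflectionSequence M :=
    ⟨rP.R, M₁, b' ≫ rP.z, k₁, rP.plus_R, U_of_realizes h₂' rA.U_S rP.U_S, ⟨_, h₁'⟩, surjM⟩
  refine ⟨rA, rB, rM, k, b ≫ rP.z, ⟨V, M₂, _, k₂, η, η₂, hV, U_of_realizes h₂'' hU rP.U_S, h₁,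
    h₁'', ?_⟩, hk.symm, ?_⟩
  -- The extensions `η` on `Y` and `ε'` on `M` agree on `B`, hence glue over `P`; the reflection of
  -- `P` then extends the result, as `V` lies in the class `h.V`.
  · obtain ⟨π, hπ⟩ := hμ.exists_pull_eq_of_pushout hb η ε' (h₃.trans hε'.symm)
    obtain ⟨ρ, hρ⟩ := rP.surjective V hV π
    exact ⟨ρ, by rw [pull_comp, hρ, hπ]⟩
  · simp only [rB, rM, ← Category.assoc, hbb']

lemma ShortPair.exists_coreflection {A B M : C} {a : A ⟶ B} {m : B ⟶ M} (H : h.ShortPair a m) :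
    ∃ (rA : h.CoreflectionSequence A) (rB : h.CoreflectionSequence B)
      (rM : h.CoreflectionSequence M) (a' : rA.R ⟶ rB.R) (m' : rB.R ⟶ rM.R),
      h.ShortPair a' m' ∧ a' ≫ rB.z = rA.z ≫ a ∧ m' ≫ rM.z = rB.z ≫ m := by
  obtain ⟨V, U, i, p, ε, μ, hV, hU, hε, hμ, ε', hε'⟩ := H
  -- The extension condition on `ε` is traded for the equivalent lifting condition on `μ`, which
  -- makes the argument dual to the one for reflections.
  obtain ⟨ν, hν⟩ := hε.exists_push_eq_of_pull hμ hε'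
  obtain ⟨rM⟩ := nonempty_coreflectionSequence (h := h) M
  obtain ⟨σ, hσ⟩ := rM.conflation
  obtain ⟨Y, d, e, k, η, hk, -, h₁, h₂, h₃, -⟩ := T.et4_op _ _ _ _ _ _ hσ hμ
  have surjB : ∀ S : C, h.U S → Function.Surjective (push T.E e : Ext T.E S Y → Ext T.E S B) := by
    intro S hS β
    obtain ⟨α, hα⟩ := rM.surjective S hS (push T.E m β)
    exact hσ.exists_push_eq_of_pullback h₂ β α hα.symm
  let rB : h.CoreflectionSequence B :=
    ⟨Y, rM.S, d, e, minus_left_of_realizes h₁ hU rM.minus_R, rM.V_S, ⟨_, h₂⟩, surjB⟩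
  obtain ⟨P, q, b, q', b', hb, hb', hbb', -, -, -⟩ :=
    Extriangulated.Realizes.exists_pullback hε h₂
  obtain ⟨rP⟩ := nonempty_coreflectionSequence (h := h) P
  obtain ⟨τ, hτ⟩ := rP.conflation
  obtain ⟨M₁, d₁, e₁, k₁, η₁, -, -, h₁', h₂', -⟩ := T.et4_op _ _ _ _ _ _ hτ hb'
  obtain ⟨M₂, d₂, e₂, k₂, η₂, -, -, h₁'', h₂'', -⟩ := T.et4_op _ _ _ _ _ _ hτ hb
  have surjA : ∀ S : C, h.U S →
      Function.Surjective (push T.E (rP.z ≫ b') : Ext T.E S rP.R → Ext T.E S A) := by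
    intro S hS β
    obtain ⟨α, hα⟩ := surjB S hS (push T.E a β)
    obtain ⟨π, hπ⟩ := Extriangulated.Realizes.exists_push_eq_of_pullback h₂ hb' β α hα.symm
    obtain ⟨ρ, hρ⟩ := rP.surjective S hS π
    exact ⟨ρ, by rw [push_comp, hρ, hπ]⟩
  let rA : h.CoreflectionSequence A :=
    ⟨rP.R, M₁, k₁, rP.z ≫ b', rP.minus_R, V_of_realizes h₂' rP.V_S rM.V_S, ⟨_, h₁'⟩, surjA⟩
  obtain ⟨π, hπ⟩ := hε.exists_push_eq_of_pullback hb η ν (h₃.trans hν.symm)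
  obtain ⟨ρ, hρ⟩ := rP.surjective U hU π
  refine ⟨rA, rB, rM, rP.z ≫ b, k, ⟨M₂, U, k₂, _, η₂, η, V_of_realizes h₂'' rP.V_S hV, hU, h₁'',
    h₁, Extriangulated.Realizes.exists_pull_eq_of_push h₁'' h₁ (ν := ρ) (by
      rw [push_comp, hρ, hπ])⟩, ?_, hk.symm⟩
  simp only [rB, rA, Category.assoc, hbb']

/-! ### Kernels and cokernels in the heart -/

/-- The morphism of the heart represented by a morphism of `C`. -/
def heartMap {X Y : h.Heart} (f : X.obj.as ⟶ Y.obj.as) : X ⟶ Y :=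
  h.quoHeart.homMk (h.toQuo.map f)

lemma heartMap_surjective {X Y : h.Heart} (f : X ⟶ Y) : ∃ g, heartMap g = f := by
  obtain ⟨g, hg⟩ := h.toQuo.map_surjective (X := X.obj.as) (Y := Y.obj.as) f.hom
  exact ⟨g, h.quoHeart.hom_ext hg⟩

lemma heartMap_comp {X Y Z : h.Heart} (f : X.obj.as ⟶ Y.obj.as) (g : Y.obj.as ⟶ Z.obj.as) :
    (heartMap (f ≫ g) : X ⟶ Z) = (heartMap f : X ⟶ Y) ≫ heartMap g :=
  h.quoHeart.hom_ext (h.toQuo.map_comp f g)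

lemma heartMap_eq {X Y : h.Heart} {f g : X.obj.as ⟶ Y.obj.as} :
    (heartMap f : X ⟶ Y) = heartMap g ↔ h.toQuo.map f = h.toQuo.map g :=
  ⟨fun e => congr_arg (fun k => k.hom) e, fun e => h.quoHeart.hom_ext e⟩

lemma heartMap_eq_zero {X Y : h.Heart} {f : X.obj.as ⟶ Y.obj.as} :
    (heartMap f : X ⟶ Y) = 0 ↔ h.toQuo.map f = 0 :=
  ⟨fun e => congr_arg (fun k => k.hom) e, fun e => h.quoHeart.hom_ext e⟩

/-- The pullback of the resolution of `B` along a monomorphism `A ⟶ B` of the heart has its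
middle term in `V`. -/
lemma V_of_mono {A B : h.Heart} (f : A.obj.as ⟶ B.obj.as) [Mono (heartMap f : A ⟶ B)]
    {V W K : C} {v : V ⟶ W} {b : W ⟶ B.obj.as} {l : Ext T.E B.obj.as V} {i : V ⟶ K}
    {k : K ⟶ A.obj.as} (hV : h.V V) (hW : h.core W) (hl : T.Realizes l v b)
    (hk : T.Realizes (pull T.E f l) i k) : h.V K := by
  obtain ⟨r⟩ := nonempty_coreflectionSequence (h := h) K
  let R : h.Heart := ⟨h.toQuo.obj r.R, r.plus_R (plus_mid_of_realizes hk hV A.property.1),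
    r.minus_R⟩
  obtain ⟨j, hj⟩ := hl.exists_lift_of_pull (k ≫ f) (by rw [pull_comp, hk.pull_eq_zero])
  -- The composite `R ⟶ K ⟶ A ⟶ B` passes through the core object `W`, so the monomorphism forces `R
  -- ⟶ A` to vanish. Since `K ⟶ A` has kernel in `V`, the coreflection map itself vanishes modulo
  -- the core.
  have h₁ : (heartMap (r.z ≫ k) : R ⟶ A) = 0 := by
    rw [← cancel_mono (heartMap f : A ⟶ B), zero_comp, ← heartMap_comp, heartMap_eq_zero,
      Category.assoc, ← hj, ← Category.assoc]
    exact map_comp_eq_zero hW _ _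
  have h₂ : h.toQuo.map r.z = 0 :=
    map_eq_zero_of_realizes_right hk hV r.minus_R _ (heartMap_eq_zero.1 h₁)
  obtain ⟨M, x, y, hM, e⟩ := (map_eq_zero_iff _).1 h₂
  -- For `X` in `U`, every element of `𝔼(X, K)` comes from `𝔼(X, r.R)` by a map factoring through
  -- `𝔼(X, M) = 0`.
  refine V_of_ext_eq_zero fun X hX β => ?_
  obtain ⟨α, rfl⟩ := r.surjective X hX β
  rw [e, push_comp, h.ext_eq_zero _ _ hX hM.2 (push T.E x α), map_zero]

lemma U_of_epi {A B : h.Heart} (f : A.obj.as ⟶ B.obj.as) [Epi (heartMap f : A ⟶ B)]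
    {U W K : C} {a : A.obj.as ⟶ W} {t : W ⟶ U} {l : Ext T.E U A.obj.as} {k : B.obj.as ⟶ K}
    {p : K ⟶ U} (hU : h.U U) (hW : h.core W) (hl : T.Realizes l a t)
    (hk : T.Realizes (push T.E f l) k p) : h.U K := by
  obtain ⟨r⟩ := nonempty_reflectionSequence (h := h) K
  let R : h.Heart := ⟨h.toQuo.obj r.R, r.plus_R,
    r.minus_R (minus_mid_of_realizes hk B.property.2 hU)⟩
  obtain ⟨j, hj⟩ := hl.exists_desc_of_push (f ≫ k) (by rw [push_comp, hk.push_eq_zero])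
  have h₁ : (heartMap (k ≫ r.z) : B ⟶ R) = 0 := by
    rw [← cancel_epi (heartMap f : A ⟶ B), comp_zero, ← heartMap_comp, heartMap_eq_zero,
      ← Category.assoc, ← hj, Category.assoc]
    exact map_comp_eq_zero hW _ _
  have h₂ : h.toQuo.map r.z = 0 :=
    map_eq_zero_of_realizes_left hk hU r.plus_R _ (heartMap_eq_zero.1 h₁)
  obtain ⟨M, x, y, hM, e⟩ := (map_eq_zero_iff _).1 h₂
  refine U_of_ext_eq_zero fun X hX β => ?_
  obtain ⟨α, rfl⟩ := r.surjective X hX β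
  rw [e, pull_comp, h.ext_eq_zero _ _ hM.1 hX (pull T.E y α), map_zero]

/-- Every morphism of the heart has a cokernel, and a monomorphism is the kernel of it. -/
lemma exists_cokernel {A B : h.Heart} (f : A ⟶ B) :
    ∃ (Z : h.Heart) (c : B ⟶ Z), f ≫ c = 0 ∧ Epi c ∧
      (∀ (Y : h.Heart) (g : B ⟶ Y), f ≫ g = 0 → ∃ k, c ≫ k = g) ∧
      (Mono f → ∀ (X : h.Heart) (g : X ⟶ B), g ≫ c = 0 → ∃ k, k ≫ f = g) := by
  obtain ⟨f, rfl⟩ := heartMap_surjective f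
  obtain ⟨W, U, w, t, hW, hU, l, hl⟩ := A.property.2
  obtain ⟨M, m, p, hm⟩ := T.exists_realizes (push T.E f l)
  obtain ⟨s, hs, -⟩ := T.realize _ _ _ _ _ _ hl hm f (𝟙 U) (pull_id _ _).symm
  obtain ⟨r⟩ := nonempty_reflectionSequence (h := h) M
  let R : h.Heart := ⟨h.toQuo.obj r.R, r.plus_R,
    r.minus_R (minus_mid_of_realizes hm B.property.2 hU)⟩
  refine ⟨R, heartMap (m ≫ r.z), ?_, Preadditive.epi_of_cancel_zero _ fun {Y} g hg => ?_,
    fun Y g hg => ?_, fun hf X g hg => ?_⟩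
  · rw [← heartMap_comp, heartMap_eq_zero, ← Category.assoc, ← hs, Category.assoc]
    exact map_comp_eq_zero hW _ _
  · obtain ⟨g, rfl⟩ := heartMap_surjective g
    obtain ⟨γ, hγ⟩ := r.conflation
    rw [← heartMap_comp, heartMap_eq_zero, Category.assoc] at hg
    exact heartMap_eq_zero.2 (map_eq_zero_of_realizes_left hγ r.U_S Y.property.1 _
      (map_eq_zero_of_realizes_left hm hU Y.property.1 _ hg))
  · obtain ⟨g, rfl⟩ := heartMap_surjective g
    rw [← heartMap_comp, heartMap_eq_zero] at hg
    obtain ⟨k, rfl⟩ := exists_desc_of_map_comp_eq_zero hm hU f rfl g hg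
    obtain ⟨k', hk'⟩ := (r.bijective Y.property.1).2 (h.toQuo.map k)
    obtain ⟨k', rfl⟩ := h.toQuo.map_surjective k'
    dsimp only at hk'
    refine ⟨heartMap (X := R) k', ?_⟩
    rw [← heartMap_comp, heartMap_eq, Category.assoc, h.toQuo.map_comp, h.toQuo.map_comp, hk',
      h.toQuo.map_comp]
  · obtain ⟨V, W', v, b, hV, hW', l', hl'⟩ := B.property.1
    obtain ⟨K, i, k, hk⟩ := T.exists_realizes (pull T.E f l')
    have hK : h.V K := V_of_mono f hV hW' hl' hk
    obtain ⟨P, j, q, b', d, hq, hd, -, hbq, -, hqd⟩ := hl'.exists_pushout hk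
    -- The conflation `W' ⟶ P ⟶ A` splits, with section `σ`. The relation `hqd` makes `σ ≫ q + f`
    -- lift to the core object `W'`, so the deflation `q`, whose kernel `K` is in `V`, represents
    -- `-f` under `σ`.
    rw [push_pull, hl'.push_eq_zero, map_zero] at hd
    obtain ⟨σ, hσ⟩ := Extriangulated.Realizes.exists_lift_of_pull hd (𝟙 _) (map_zero _)
    obtain ⟨e, he⟩ := hl'.exists_lift_of_pull (σ ≫ q + f) (by
      rw [pull_add _ T.additive_left, pull_comp, ← Category.id_comp f, ← hσ, Category.assoc,
        pull_comp T.E σ (d ≫ f), ← map_add, pull_comp, hqd, map_zero])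
    have hf' : f = e ≫ b - σ ≫ q := by rw [he, add_sub_cancel_left]
    -- By the lifting duality, the class of `K ⟶ P ⟶ B` extends along `m` once `push f l` lifts
    -- along `q`. The lift is `-push σ l`, because `f` and `-(σ ≫ q)` differ by a map through `W'`
    -- and `𝔼(U, W') = 0`.
    obtain ⟨ε, hε⟩ := hq.exists_pull_eq_of_push hm (ν := - push T.E σ l) (by
      rw [map_neg, ← push_comp, hf', push_sub _ T.additive_right, push_comp T.E e,
        h.ext_eq_zero _ _ hU hW'.2 (push T.E e l), map_zero, zero_sub])
    -- This is where `K` in `V` is needed: the extension passes from `M` on to its reflection, so a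
    -- morphism killed by the cokernel map lifts through `q`.
    obtain ⟨η, rfl⟩ := r.surjective K hK ε
    rw [← pull_comp] at hε
    obtain ⟨g, rfl⟩ := heartMap_surjective g
    rw [← heartMap_comp, heartMap_eq_zero] at hg
    obtain ⟨n, rfl⟩ := exists_lift_of_map_comp_eq_zero hq hK _ hε g hg
    -- The lift `n` is replaced by its component along `σ`, up to a map through `W'`; the sign of
    -- the factorization reflects that `q` represents `-f`.
    obtain ⟨o, ho⟩ := Extriangulated.Realizes.exists_lift hd (n - n ≫ d ≫ σ) (by
      simp [hσ])
    refine ⟨heartMap (-(n ≫ d)), ?_⟩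
    rw [← heartMap_comp, heartMap_eq, ← sub_eq_zero, ← h.toQuo.map_sub]
    have : (-(n ≫ d)) ≫ f - n ≫ q = -((n ≫ d ≫ e + o) ≫ b) := by
      rw [← hbq, ← Category.assoc _ b', Preadditive.add_comp _ _ _ _ _ b', ho, hf', ← hbq]
      simp
      abel
    rw [this, Functor.map_neg, map_comp_eq_zero hW', neg_zero]

/-- Every morphism of the heart has a kernel, and an epimorphism is the cokernel of it. -/
lemma exists_kernel {A B : h.Heart} (f : A ⟶ B) :
    ∃ (Z : h.Heart) (c : Z ⟶ A), c ≫ f = 0 ∧ Mono c ∧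
      (∀ (X : h.Heart) (g : X ⟶ A), g ≫ f = 0 → ∃ k, k ≫ c = g) ∧
      (Epi f → ∀ (Y : h.Heart) (g : A ⟶ Y), c ≫ g = 0 → ∃ k, f ≫ k = g) := by
  obtain ⟨f, rfl⟩ := heartMap_surjective f
  obtain ⟨V, W, t, w, hV, hW, l, hl⟩ := B.property.1
  obtain ⟨M, p, m, hm⟩ := T.exists_realizes (pull T.E f l)
  obtain ⟨s, -, hs⟩ := T.realize _ _ _ _ _ _ hm hl (𝟙 V) f (push_id _ _)
  obtain ⟨r⟩ := nonempty_coreflectionSequence (h := h) M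
  let R : h.Heart := ⟨h.toQuo.obj r.R, r.plus_R (plus_mid_of_realizes hm hV A.property.1),
    r.minus_R⟩
  refine ⟨R, heartMap (r.z ≫ m), ?_, Preadditive.mono_of_cancel_zero _ fun {Y} g hg => ?_,
    fun Y g hg => ?_, fun hf X g hg => ?_⟩
  · rw [← heartMap_comp, heartMap_eq_zero, Category.assoc, hs, ← Category.assoc]
    exact map_comp_eq_zero hW _ _
  · obtain ⟨g, rfl⟩ := heartMap_surjective g
    obtain ⟨γ, hγ⟩ := r.conflation
    rw [← heartMap_comp, heartMap_eq_zero, ← Category.assoc] at hg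
    exact heartMap_eq_zero.2 (map_eq_zero_of_realizes_right hγ r.V_S Y.property.2 _
      (map_eq_zero_of_realizes_right hm hV Y.property.2 _ hg))
  · obtain ⟨g, rfl⟩ := heartMap_surjective g
    rw [← heartMap_comp, heartMap_eq_zero] at hg
    obtain ⟨k, rfl⟩ := exists_lift_of_map_comp_eq_zero hm hV f rfl g hg
    obtain ⟨k', hk'⟩ := (r.bijective Y.property.2).2 (h.toQuo.map k)
    obtain ⟨k', rfl⟩ := h.toQuo.map_surjective k'
    dsimp only at hk'
    refine ⟨heartMap (Y := R) k', ?_⟩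
    rw [← heartMap_comp, heartMap_eq, ← Category.assoc, h.toQuo.map_comp, h.toQuo.map_comp, hk',
      h.toQuo.map_comp]
  · obtain ⟨W', U, b, v, hW', hU, l', hl'⟩ := A.property.2
    obtain ⟨K, k, i, hk⟩ := T.exists_realizes (push T.E f l')
    have hK : h.U K := U_of_epi f hU hW' hl' hk
    obtain ⟨P, q, j, d, b', hq, hd, -, hbq, -, hqd⟩ := hl'.exists_pullback hk
    -- Dually, `K ⟶ P ⟶ W'`-type data splits: `d` has a retraction `σ`, and the inflation `q`, with
    -- cone `K` in `U`, represents `-f` modulo the core object `W'`.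
    rw [← push_pull, hl'.pull_eq_zero, map_zero] at hd
    obtain ⟨σ, hσ⟩ := Extriangulated.Realizes.exists_desc_of_push hd (𝟙 _) (map_zero _)
    obtain ⟨e, he⟩ := hl'.exists_desc_of_push (q ≫ σ + f) (by
      rw [push_add _ T.additive_right, push_comp, ← Category.comp_id f, ← hσ, ← Category.assoc,
        push_comp T.E (f ≫ d) σ, ← map_add, push_comp, hqd, map_zero])
    have hf' : f = b ≫ e - q ≫ σ := by rw [he, add_sub_cancel_left]
    obtain ⟨ε, hε⟩ := hm.exists_push_eq_of_pull hq (ε := - pull T.E σ l) (by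
      rw [map_neg, ← pull_comp, hf', pull_sub _ T.additive_left, pull_comp T.E b,
        h.ext_eq_zero _ _ hW'.1 hV (pull T.E e l), map_zero, zero_sub])
    obtain ⟨η, rfl⟩ := r.surjective K hK ε
    rw [← push_comp] at hε
    obtain ⟨g, rfl⟩ := heartMap_surjective g
    rw [← heartMap_comp, heartMap_eq_zero] at hg
    obtain ⟨n, rfl⟩ := exists_desc_of_map_comp_eq_zero hq hK _ hε g hg
    obtain ⟨o, ho⟩ := Extriangulated.Realizes.exists_desc hd (n - σ ≫ d ≫ n) (by
      rw [Preadditive.comp_sub, reassoc_of% hσ, sub_self])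
    refine ⟨heartMap (-(d ≫ n)), ?_⟩
    rw [← heartMap_comp, heartMap_eq, ← sub_eq_zero, ← h.toQuo.map_sub]
    have : f ≫ (-(d ≫ n)) - q ≫ n = -(b ≫ (e ≫ d ≫ n + o)) := by
      rw [← hbq, Category.assoc, Preadditive.comp_add _ _ _ b', ho, hf', ← hbq]
      simp
      abel
    rw [this, Functor.map_neg, map_comp_eq_zero hW', neg_zero]

/-! ### The abelian structure of the heart -/

lemma plus_biprod {X Y : C} (hX : h.plus X) (hY : h.plus Y) : h.plus (X ⊞ Y) := by
  obtain ⟨V, W, v, w, hV, hW, l, hl⟩ := hX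
  obtain ⟨V', W', v', w', hV', hW', l', hl'⟩ := hY
  exact ⟨_, _, _, _, h.hV.biprod _ _ hV hV', ⟨h.hU.biprod _ _ hW.1 hW'.1,
    h.hV.biprod _ _ hW.2 hW'.2⟩, _, T.s_sum _ _ _ _ _ _ hl hl'⟩

lemma minus_biprod {X Y : C} (hX : h.minus X) (hY : h.minus Y) : h.minus (X ⊞ Y) := by
  obtain ⟨W, U, w, u, hW, hU, l, hl⟩ := hX
  obtain ⟨W', U', w', u', hW', hU', l', hl'⟩ := hY
  exact ⟨_, _, _, _, ⟨h.hU.biprod _ _ hW.1 hW'.1, h.hV.biprod _ _ hW.2 hW'.2⟩,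
    h.hU.biprod _ _ hU hU', _, T.s_sum _ _ _ _ _ _ hl hl'⟩

lemma heart_hasBinaryBiproducts : HasBinaryBiproducts h.Heart where
  has_binary_biproduct X Y :=
    let P : h.Heart := ⟨h.toQuo.obj (X.obj.as ⊞ Y.obj.as),
      plus_biprod X.property.1 Y.property.1, minus_biprod X.property.2 Y.property.2⟩
    have map_id (Z : h.Heart) : (heartMap (𝟙 Z.obj.as) : Z ⟶ Z) = 𝟙 Z :=
      h.quoHeart.hom_ext (h.toQuo.map_id _)
    hasBinaryBiproduct_of_total (X := X) (Y := Y)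
      { pt := P
        fst := heartMap (X := P) biprod.fst
        snd := heartMap (X := P) biprod.snd
        inl := heartMap (Y := P) biprod.inl
        inr := heartMap (Y := P) biprod.inr
        inl_fst := by rw [← heartMap_comp, biprod.inl_fst, map_id]
        inl_snd := by
          rw [← heartMap_comp, biprod.inl_snd, heartMap_eq_zero, Functor.map_zero]
        inr_fst := by
          rw [← heartMap_comp, biprod.inr_fst, heartMap_eq_zero, Functor.map_zero]
        inr_snd := by rw [← heartMap_comp, biprod.inr_snd, map_id] }
      (by
        have total : h.toQuo.map (biprod.fst : X.obj.as ⊞ Y.obj.as ⟶ _) ≫ h.toQuo.map biprod.inl +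
            h.toQuo.map biprod.snd ≫ h.toQuo.map biprod.inr = 𝟙 _ := by
          rw [← h.toQuo.map_comp, ← h.toQuo.map_comp, ← h.toQuo.map_add, biprod.total,
            h.toQuo.map_id]
        exact h.quoHeart.hom_ext total)

lemma heart_hasZeroObject : HasZeroObject h.Heart := by
  obtain ⟨O, hO⟩ := exists_isZero (C := C)
  have hU := h.hU.zero _ hO
  have hV := h.hV.zero _ hO
  let P : h.Heart := ⟨h.toQuo.obj O, ⟨O, O, _, _, hV, ⟨hU, hV⟩, _, T.realizes_id_zero O O hO⟩,
    ⟨O, O, _, _, ⟨hU, hV⟩, hU, _, T.realizes_id_zero O O hO⟩⟩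
  have map_id : h.toQuo.map (𝟙 O) = 0 := by rw [hO.eq_of_src (𝟙 O) 0, Functor.map_zero]
  have : 𝟙 P = 0 := h.quoHeart.hom_ext ((h.toQuo.map_id O).symm.trans map_id)
  exact ⟨P, (IsZero.iff_id_eq_zero P).2 this⟩

lemma heart_hasFiniteProducts : HasFiniteProducts h.Heart :=
  have := heart_hasBinaryBiproducts (h := h)
  have := heart_hasZeroObject (h := h)
  hasFiniteProducts_of_has_binary_and_terminal

lemma heart_isNormalMonoCategory : IsNormalMonoCategory h.Heart where
  normalMonoOfMono f hf := by
    obtain ⟨Z, c, hc, -, -, hlift⟩ := exists_cokernel f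
    exact ⟨⟨Z, c, hc, KernelFork.IsLimit.ofι' f hc fun g hg =>
      ⟨_, (hlift hf _ g hg).choose_spec⟩⟩⟩

lemma heart_isNormalEpiCategory : IsNormalEpiCategory h.Heart where
  normalEpiOfEpi f hf := by
    obtain ⟨Z, c, hc, -, -, hdesc⟩ := exists_kernel f
    exact ⟨⟨Z, c, hc, CokernelCofork.IsColimit.ofπ' f hc fun g hg =>
      ⟨_, (hdesc hf _ g hg).choose_spec⟩⟩⟩

lemma heart_hasKernels : HasKernels h.Heart where
  has_limit f := by
    obtain ⟨Z, c, hc, hmono, hlift, -⟩ := exists_kernel f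
    exact ⟨⟨⟨_, KernelFork.IsLimit.ofι' c hc fun g hg => ⟨_, (hlift _ g hg).choose_spec⟩⟩⟩⟩

lemma heart_hasCokernels : HasCokernels h.Heart where
  has_colimit f := by
    obtain ⟨Z, c, hc, hepi, hdesc, -⟩ := exists_cokernel f
    exact ⟨⟨⟨_, CokernelCofork.IsColimit.ofπ' c hc fun g hg => ⟨_, (hdesc _ g hg).choose_spec⟩⟩⟩⟩

variable (h) in
/-- The heart of a cotorsion pair is an abelian category. -/
@[reducible]
def heartAbelian : Abelian h.Heart :=
  { h.heartPreadditive, heart_isNormalMonoCategory (h := h),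
    heart_isNormalEpiCategory (h := h) with
    has_finite_products := heart_hasFiniteProducts
    has_kernels := heart_hasKernels
    has_cokernels := heart_hasCokernels }

/-! ### Short pairs modulo the core -/

section ShortPairs

variable {A B M : C} {a : A ⟶ B} {m : B ⟶ M}

lemma ShortPair.map_eq_zero_left (H : h.ShortPair a m) {X : C} (hX : h.minus X) (f : X ⟶ A)
    (hf : h.toQuo.map (f ≫ a) = 0) : h.toQuo.map f = 0 := by
  obtain ⟨V, U, i, p, ε, μ, hV, hU, hε, hμ, -⟩ := H
  exact map_eq_zero_of_realizes_right hε hV hX f hf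

lemma ShortPair.map_eq_zero_right (H : h.ShortPair a m) {Y : C} (hY : h.plus Y) (f : M ⟶ Y)
    (hf : h.toQuo.map (m ≫ f) = 0) : h.toQuo.map f = 0 := by
  obtain ⟨V, U, i, p, ε, μ, hV, hU, hε, hμ, -⟩ := H
  exact map_eq_zero_of_realizes_left hμ hU hY f hf

lemma ShortPair.exists_lift (H : h.ShortPair a m) {X : C} (f : X ⟶ B)
    (hf : h.toQuo.map (f ≫ m) = 0) : ∃ k : X ⟶ A, k ≫ a = f := by
  obtain ⟨V, U, i, p, ε, μ, hV, hU, hε, hμ, ε', hε'⟩ := H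
  exact exists_lift_of_map_comp_eq_zero hε hV m hε' f hf

/-- Together with its dual, this degenerate case lets the statement on short pairs also show that
`H` sends inflations with cone in `U` to epimorphisms and deflations with kernel in `V` to
monomorphisms. -/
lemma shortPair_id_left {S : C} {μ : Ext T.E S B} {p : M ⟶ S} (hμ : T.Realizes μ m p)
    (hS : h.U S) : h.ShortPair (𝟙 B) m := by
  obtain ⟨O, hO⟩ := exists_isZero (C := C)
  exact ⟨O, S, 0, p, 0, μ, h.hV.zero _ hO, hS, T.realizes_zero_id B O hO, hμ, 0, map_zero _⟩

lemma shortPair_id_right {S : C} {ε : Ext T.E B S} {i : S ⟶ A} (hε : T.Realizes ε i a)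
    (hS : h.V S) : h.ShortPair a (𝟙 B) := by
  obtain ⟨O, hO⟩ := exists_isZero (C := C)
  exact ⟨S, O, i, 0, ε, 0, hS, h.hU.zero _ hO, hε, T.realizes_id_zero B O hO, ε, pull_id _ _⟩

end ShortPairs

/-! ### Independence of `H` from the chosen reflections and coreflections -/

/-- The object of the heart obtained from an object by a reflection followed by a coreflection. -/
abbrev ReflectionSequence.heartObj {A : C} (r : h.ReflectionSequence A)
    (k : h.CoreflectionSequence r.R) : h.Heart :=
  ⟨h.toQuo.obj k.R, k.plus_R r.plus_R, k.minus_R⟩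

section Induces

variable {A B M : C} {rA : h.ReflectionSequence A} {kA : h.CoreflectionSequence rA.R}
  {rB : h.ReflectionSequence B} {kB : h.CoreflectionSequence rB.R}
  {rM : h.ReflectionSequence M} {kM : h.CoreflectionSequence rM.R}

/-- A morphism `φ` of the heart is induced by `f` if both are compatible with the reflections and
coreflections. -/
def Induces (rA : h.ReflectionSequence A) (kA : h.CoreflectionSequence rA.R)
    (rB : h.ReflectionSequence B) (kB : h.CoreflectionSequence rB.R)
    (f : A ⟶ B) (φ : rA.heartObj kA ⟶ rB.heartObj kB) : Prop :=
  ∃ g : h.toQuo.obj rA.R ⟶ h.toQuo.obj rB.R,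
    h.toQuo.map rA.z ≫ g = h.toQuo.map f ≫ h.toQuo.map rB.z ∧
    φ.hom ≫ h.toQuo.map kB.z = h.toQuo.map kA.z ≫ g

variable (rA kA rB kB) in
lemma exists_induces (f : A ⟶ B) : ∃ φ, Induces rA kA rB kB f φ := by
  obtain ⟨g, hg⟩ := (rA.bijective rB.plus_R).2 (h.toQuo.map f ≫ h.toQuo.map rB.z)
  obtain ⟨φ, hφ⟩ := (kB.bijective kA.minus_R).2 (h.toQuo.map kA.z ≫ g)
  exact ⟨h.quoHeart.homMk φ, g, hg, hφ⟩

lemma Induces.unique {f : A ⟶ B} {φ ψ : rA.heartObj kA ⟶ rB.heartObj kB}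
    (hφ : Induces rA kA rB kB f φ) (hψ : Induces rA kA rB kB f ψ) : φ = ψ := by
  obtain ⟨g, hg, hφ⟩ := hφ
  obtain ⟨g', hg', hψ⟩ := hψ
  obtain rfl := (rA.bijective rB.plus_R).1 (hg.trans hg'.symm)
  exact h.quoHeart.hom_ext ((kB.bijective kA.minus_R).1 (hφ.trans hψ.symm))

lemma Induces.comp {f : A ⟶ B} {f' : B ⟶ M} {φ : rA.heartObj kA ⟶ rB.heartObj kB}
    {φ' : rB.heartObj kB ⟶ rM.heartObj kM} (hφ : Induces rA kA rB kB f φ)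
    (hφ' : Induces rB kB rM kM f' φ') : Induces rA kA rM kM (f ≫ f') (φ ≫ φ') := by
  obtain ⟨g, hg, hφ⟩ := hφ
  obtain ⟨g', hg', hφ'⟩ := hφ'
  refine ⟨g ≫ g', by rw [reassoc_of% hg, hg', h.toQuo.map_comp, Category.assoc], ?_⟩
  rw [ObjectProperty.FullSubcategory.comp_hom, Category.assoc, hφ', reassoc_of% hφ]

lemma Induces.add {f f' : A ⟶ B} {φ φ' : rA.heartObj kA ⟶ rB.heartObj kB}
    (hφ : Induces rA kA rB kB f φ) (hφ' : Induces rA kA rB kB f' φ') :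
    Induces rA kA rB kB (f + f') (φ + φ') := by
  obtain ⟨g, hg, hφ⟩ := hφ
  obtain ⟨g', hg', hφ'⟩ := hφ'
  refine ⟨g + g', by rw [Preadditive.comp_add, hg, hg', h.toQuo.map_add, Preadditive.add_comp], ?_⟩
  rw [Preadditive.comp_add, ← hφ, ← hφ']
  exact Preadditive.add_comp _ _ _ φ.hom φ'.hom _

variable (rA kA) in
lemma induces_id : Induces rA kA rA kA (𝟙 A) (𝟙 _) :=
  ⟨𝟙 _, by rw [h.toQuo.map_id, Category.comp_id, Category.id_comp],
    (Category.id_comp _).trans (Category.comp_id _).symm⟩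

lemma Induces.isIso {φ : rA.heartObj kA ⟶ rB.heartObj kB} {f : A ⟶ B} [IsIso f]
    (hφ : Induces rA kA rB kB f φ) : IsIso φ := by
  obtain ⟨ψ, hψ⟩ := exists_induces rB kB rA kA (inv f)
  refine ⟨ψ, (hφ.comp hψ).unique ?_, (hψ.comp hφ).unique ?_⟩
  · rw [IsIso.hom_inv_id]
    exact induces_id _ _
  · rw [IsIso.inv_hom_id]
    exact induces_id _ _

end Induces

variable (ρ : ∀ B : C, h.ReflectionSequence B) (κ : ∀ B : C, h.CoreflectionSequence B)

/-- Both `σ⁺` and `σ⁻` are defined on morphisms by inverting the universal bijections, so the two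
compatibility squares are instances of `apply_symm_apply`. -/
lemma induces_H_map {A B : C} (f : A ⟶ B) :
    Induces (ρ A) (κ _) (ρ B) (κ _) f ((H ρ κ).map f) := by
  refine ⟨((sigmaPlus ρ).map (h.toQuo.map f)).hom, ?_, ?_⟩
  · have hg : plusEquiv ρ _ _ ((sigmaPlus ρ).map (h.toQuo.map f)) =
        h.toQuo.map f ≫ plusEquiv ρ _ _ (𝟙 _) :=
      (plusEquiv ρ (h.toQuo.obj A) ((sigmaPlus ρ).obj (h.toQuo.obj B))).apply_symm_apply _
    exact hg.trans (congr_arg (h.toQuo.map f ≫ ·) (Category.comp_id (h.toQuo.map (ρ B).z)))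
  · have hφ : minusEquiv κ _ _ ((sigmaMinus κ).map ((sigmaPlus ρ).map (h.toQuo.map f)).hom) =
        minusEquiv κ _ _ (𝟙 _) ≫ ((sigmaPlus ρ).map (h.toQuo.map f)).hom :=
      (minusEquiv κ ((sigmaMinus κ).obj ((sigmaPlus ρ).obj (h.toQuo.obj A)).obj)
        ((sigmaPlus ρ).obj (h.toQuo.obj B)).obj).apply_symm_apply _
    exact hφ.trans (congr_arg (· ≫ ((sigmaPlus ρ).map (h.toQuo.map f)).hom)
      (Category.id_comp (h.toQuo.map (κ (ρ A).R).z)))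

/-- This permits computing `H` with (co)reflections adapted to a given short pair instead of the
ones fixed by `ρ` and `κ`. -/
lemma exists_H_obj_iso {A : C} (r : h.ReflectionSequence A) (k : h.CoreflectionSequence r.R) :
    ∃ α : (H ρ κ).obj A ≅ r.heartObj k, Induces (ρ A) (κ _) r k (𝟙 A) α.hom := by
  obtain ⟨α, hα⟩ := exists_induces (ρ A) (κ _) r k (𝟙 A)
  have := hα.isIso
  exact ⟨@asIso _ _ ((H ρ κ).obj A) _ α this, hα⟩

lemma H_additive : (H ρ κ).Additive where
  map_add := (induces_H_map ρ κ _).unique ((induces_H_map ρ κ _).add (induces_H_map ρ κ _))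

/-- The functor `H` sends short pairs to a monomorphism and an epimorphism which form an exact
sequence as soon as their composition vanishes. -/
lemma ShortPair.map_H {A B M : C} {a : A ⟶ B} {m : B ⟶ M} (hs : h.ShortPair a m) :
    Mono ((H ρ κ).map a) ∧ Epi ((H ρ κ).map m) ∧
      ∀ (X : h.Heart) (g : X ⟶ (H ρ κ).obj B), g ≫ (H ρ κ).map m = 0 →
        ∃ k, k ≫ (H ρ κ).map a = g := by
  obtain ⟨rA, rB, rM, a', m', hs', ha', hm'⟩ := hs.exists_reflection
  obtain ⟨kA, kB, kM, a'', m'', hs'', ha'', hm''⟩ := hs'.exists_coreflection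
  have ha : Induces rA kA rB kB a (heartMap a'') := ⟨h.toQuo.map a',
    by rw [← h.toQuo.map_comp, ha', h.toQuo.map_comp],
    by
      rw [← h.toQuo.map_comp, ← ha'', h.toQuo.map_comp]
      rfl⟩
  have hm : Induces rB kB rM kM m (heartMap m'') := ⟨h.toQuo.map m',
    by rw [← h.toQuo.map_comp, hm', h.toQuo.map_comp],
    by
      rw [← h.toQuo.map_comp, ← hm'', h.toQuo.map_comp]
      rfl⟩
  obtain ⟨α, hα⟩ := exists_H_obj_iso ρ κ rA kA
  obtain ⟨β, hβ⟩ := exists_H_obj_iso ρ κ rB kB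
  obtain ⟨μ, hμ⟩ := exists_H_obj_iso ρ κ rM kM
  have ea : (H ρ κ).map a ≫ β.hom = α.hom ≫ (heartMap a'' : _ ⟶ rB.heartObj kB) :=
    ((induces_H_map ρ κ a).comp hβ).unique (by
      rw [Category.comp_id, ← Category.id_comp a]
      exact hα.comp ha)
  have em : (H ρ κ).map m ≫ μ.hom = β.hom ≫ (heartMap m'' : _ ⟶ rM.heartObj kM) :=
    ((induces_H_map ρ κ m).comp hμ).unique (by
      rw [Category.comp_id, ← Category.id_comp m]
      exact hβ.comp hm)
  have mono : Mono (heartMap a'' : rA.heartObj kA ⟶ rB.heartObj kB) :=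
    Preadditive.mono_of_cancel_zero _ fun {X} g hg => by
      obtain ⟨g, rfl⟩ := heartMap_surjective g
      rw [← heartMap_comp, heartMap_eq_zero] at hg
      exact heartMap_eq_zero.2 (hs''.map_eq_zero_left X.property.2 _ hg)
  have epi : Epi (heartMap m'' : rB.heartObj kB ⟶ rM.heartObj kM) :=
    Preadditive.epi_of_cancel_zero _ fun {X} g hg => by
      obtain ⟨g, rfl⟩ := heartMap_surjective g
      rw [← heartMap_comp, heartMap_eq_zero] at hg
      exact heartMap_eq_zero.2 (hs''.map_eq_zero_right X.property.1 _ hg)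
  have em' : (H ρ κ).map m = β.hom ≫ (heartMap m'' : _ ⟶ rM.heartObj kM) ≫ μ.inv := by
    rw [← Category.assoc, ← em, Category.assoc, μ.hom_inv_id, Category.comp_id]
  refine ⟨mono_of_mono_fac ea, em' ▸ inferInstance, ?_⟩
  intro X g hg
  obtain ⟨g', hg'⟩ := heartMap_surjective (g ≫ β.hom)
  -- The reflected and coreflected pair is again short, so its lifting property holds in `C` and
  -- descends to the heart; the isomorphisms `α`, `β`, `μ` transport it to `H`.
  obtain ⟨k, hk⟩ := hs''.exists_lift g' (by
    rw [← heartMap_eq_zero (X := X) (Y := rM.heartObj kM), heartMap_comp (Y := rB.heartObj kB),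
      hg', Category.assoc, ← em, reassoc_of% hg, zero_comp])
  refine ⟨heartMap (Y := rA.heartObj kA) k ≫ α.inv, ?_⟩
  rw [← cancel_mono β.hom, Category.assoc, Category.assoc, ea, α.inv_hom_id_assoc, ← hg', ← hk,
    heartMap_comp (Y := rA.heartObj kA)]

lemma H_isCohomological : @IsCohomological _ _ _ _ _ T _ _ h.heartAbelian (H ρ κ) := by
  let _ := h.heartAbelian
  have hadd : (H ρ κ).Additive := H_additive ρ κ
  refine ⟨hadd, ?_⟩
  rintro A B Z x y ⟨δ, hδ⟩
  have hxy : (H ρ κ).map x ≫ (H ρ κ).map y = 0 := by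
    rw [← Functor.map_comp, hδ.comp_eq_zero, Functor.map_zero]
  obtain ⟨V, U, i, v, hV, hU, γ, hγ⟩ := h.left_res Z
  obtain ⟨V', U', u, p, hV', hU', α, hα⟩ := h.right_res A
  -- Pulling back along `U ⟶ Z` factors `x` as `q ≫ b`, where `q` has cone in `U`; pushing out along
  -- `A ⟶ V'` factors `y` as `b' ≫ q'`, where `q'` has kernel in `V`.
  obtain ⟨P, q, r, e, b, hq, hb, -, rfl, -, -⟩ :=
    Extriangulated.Realizes.exists_pullback hδ hγ
  obtain ⟨P', r', q', b', e', hq', hb', -, rfl, -, -⟩ :=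
    Extriangulated.Realizes.exists_pushout hδ hα
  -- The class of `b` is the pullback of `γ` along `b' ≫ q'`, so it extends along `b'` to `pull q'
  -- γ`.
  have hs : h.ShortPair b b' := ⟨_, _, _, _, _, _, hV, hU', hb, hb', pull T.E q' γ,
    (pull_comp _ _ _ _).symm⟩
  obtain ⟨hb₁, -, hb₂⟩ := hs.map_H ρ κ
  have hq₁ : Epi ((H ρ κ).map q) := ((shortPair_id_left hq hU).map_H ρ κ).2.1
  have hq₂ : Mono ((H ρ κ).map q') := ((shortPair_id_right hq' hV').map_H ρ κ).1
  -- The composite `b ≫ b'` need not vanish in `C`, but its image under `H` does: `H(x) ≫ H(y) = 0`,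
  -- and the outer factors `H(q)` and `H(q')` can be cancelled.
  have h₁ : (H ρ κ).map (q ≫ b) ≫ (H ρ κ).map b' = 0 := by
    rw [← cancel_mono ((H ρ κ).map q'), Category.assoc, ← Functor.map_comp, hxy, zero_comp]
  have h₂ : (H ρ κ).map b ≫ (H ρ κ).map b' = 0 := by
    rw [← cancel_epi ((H ρ κ).map q), ← Category.assoc, ← Functor.map_comp, h₁, comp_zero]
  have exact₂ : (ShortComplex.mk _ _ h₂).Exact := ShortComplex.exact_of_f_is_kernel _
    (KernelFork.IsLimit.ofι' _ h₂ fun g hg => ⟨_, (hb₂ _ g hg).choose_spec⟩)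
  let φ : ShortComplex.mk _ _ h₁ ⟶ ShortComplex.mk _ _ h₂ :=
    { τ₁ := (H ρ κ).map q, τ₂ := 𝟙 _, τ₃ := 𝟙 _ }
  let ψ : ShortComplex.mk _ _ h₁ ⟶ ShortComplex.mk _ _ hxy :=
    { τ₁ := 𝟙 _, τ₂ := 𝟙 _, τ₃ := (H ρ κ).map q' }
  have : Epi φ.τ₁ := hq₁
  have : Mono ψ.τ₃ := hq₂
  have : Epi ψ.τ₁ := inferInstanceAs (Epi (𝟙 _))
  have : IsIso ψ.τ₂ := inferInstanceAs (IsIso (𝟙 _))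
  have : IsIso φ.τ₂ := inferInstanceAs (IsIso (𝟙 _))
  have : Mono φ.τ₃ := inferInstanceAs (Mono (𝟙 _))
  exact ⟨hxy, (ShortComplex.exact_iff_of_epi_of_isIso_of_mono ψ).1
    ((ShortComplex.exact_iff_of_epi_of_isIso_of_mono φ).2 exact₂)⟩

end CotorsionPair

end ExtriCat

end

theorem theorem8p11 {C : Type u} [Category.{v} C] [Preadditive C] [HasZeroObject C]
    [HasBinaryBiproducts C]
    (T : ExtriCat.Extriangulated.{w} C) (h : ExtriCat.CotorsionPair T)
    (ρ : ∀ B : C, h.ReflectionSequence B) (κ : ∀ B : C, h.CoreflectionSequence B) :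
    ∃ i : Abelian h.Heart,
      i.toPreadditive = h.heartPreadditive ∧
      ExtriCat.IsCohomological T (ExtriCat.CotorsionPair.H ρ κ) :=
  ⟨h.heartAbelian, rfl, ExtriCat.CotorsionPair.H_isCohomological ρ κ⟩
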